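/- **Setting.** Let $d_x,d_y\ge 1$, ${\bf A}\in\mathbb R^{d_y\times d_x}$, $f:\mathbb R^{d_x}\to\mathbb R$, $g:\mathbb R^{d_y}\to\mathbb R$ differentiable, $f$ $\mu_x$-strongly convex and $L_x$-smooth, $g$ $\mu_y$-strongly convex and $L_y$-smooth, where $\mu_x,\mu_y\ge 0$, $L_x,L_y>0$; here $h$ is $L$-smooth if $\|\nabla h(u)-\nabla h(v)\|\le L\|u-v\|$, and $\mu$-strongly convex if $h(u)\ge h(v)+\langle\nabla h(v),u-v\rangle+\frac\mu2\|u-v\|^2$, for all $u,v$. Suppose that $\min_x\max_y f(x)+y^\top{\bf A}x-g(y)$ has a solution (saddle point). A vector $s$ is a $(\delta,L,\mu)$-model of $h$ at $u$ if for some $c\in\mathbb R$ and all $v$: $\frac\mu2\|v-u\|^2\le h(v)-(c+\langle s,v-u\rangle)\le\frac L2\|v-u\|^2+\delta$. *Oracles.* Let $r_f,r_g\ge1$ be batch sizes and $\xi_x^{k,i},\xi_y^{k,j}$ ($k\ge0$, $1\le i\le r_f$, $1\le j\le r_g$) independent random variables; $\xi^{k-1}$ denotes all those with first index $<k$. At iteration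 $k$ the oracles return $\nabla f_\delta(x,\xi_x^{k,i},\xi^{k-1})$ and $\nabla g_\delta(y,\xi_y^{k,j},\xi^{k-1})$ (square integrable, jointly measurable). At the queried points $x=x_g^k$, $y=y_g^k$ below and almost surely: the expectation of the former over $\xi_x^{k,i}$ is a $(\delta_x(\xi^{k-1}),L_x,\mu_x)$-model of $f$ at $x$ and its variance (expected squared distance from that expectation) is at most $\sigma_f^2$; the expectation of the latter over $\xi_y^{k,j}$ is a $(\delta_y(\xi^{k-1}),L_y,\mu_y)$-model of $g$ at $y$ and its variance is at most $\sigma_g^2$. The inexactness levels may depend on $k$, are integrable, and $\mathbb E\,\delta_x(\xi^{k-1})\le\delta_x$, $\mathbb E\,\delta_y(\xi^{k-1})\le\delta_y$ for all $k$. *Coupling constants.* $L_{xy}>0$, $\mu_{xy},\mu_{yx}\ge0$ satisfy $L_{xy}^2\ge\lambda_{\max}({\bf A}^\top{\bf A})$; $\mu_{xy}^2\le\lambda_{\min}^+({\bf A}{\bf A}^\top)$ if all gradients of $g$ (both $\nabla g(y)$ and all stochastic oracle outputs) lie in $\operatorname{range}{\bf A}$, and $\mu_{xy}^2\le\lambda_{\min}({\bf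 A}{\bf A}^\top)$ otherwise; $\mu_{yx}^2\le\lambda^+_{\min}({\bf A}^\top{\bf A})$ if all gradients of $f$ (exact and stochastic) lie in $\operatorname{range}{\bf A}^\top$, and $\mu_{yx}^2\le\lambda_{\min}({\bf A}^\top{\bf A})$ otherwise. ($\lambda_{\min}^+$ is the smallest positive eigenvalue, read as $0$ if ${\bf A}=0$.) *Algorithm (inexact stochastic APDG).* Parameters: $\eta_x,\eta_y,\beta_x,\beta_y>0$, $\alpha_x,\alpha_y\ge0$ ($\alpha_x>0$ if $\mu_x>0$, $\alpha_y>0$ if $\mu_y>0$), $\tau_x,\tau_y,\sigma_x,\sigma_y\in(0,1]$, $\theta\in(0,1)$. Start: $x_f^0=x^0\in\operatorname{range}{\bf A}^\top$, $y_f^0=y^{-1}=y^0\in\operatorname{range}{\bf A}$. For $k=0,1,\dots$, with $\nabla f_k=\frac1{r_f}\sum_i\nabla f_\delta(x_g^k,\xi_x^{k,i},\xi^{k-1})$, $\nabla g_k=\frac1{r_g}\sum_j\nabla g_\delta(y_g^k,\xi_y^{k,j},\xi^{k-1})$: $$y_m^k=y^k+\theta(y^k-y^{k-1}),\quad x_g^k=\tau_xx^k+(1-\tau_x)x_f^k,\quad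 y_g^k=\tau_yy^k+(1-\tau_y)y_f^k,$$ $$x^{k+1}=x^k+\eta_x\alpha_x(x_g^k-x^k)-\eta_x\beta_x{\bf A}^\top({\bf A}x^k-\nabla g_k)-\eta_x(\nabla f_k+{\bf A}^\top y_m^k),$$ $$y^{k+1}=y^k+\eta_y\alpha_y(y_g^k-y^k)-\eta_y\beta_y{\bf A}({\bf A}^\top y^k+\nabla f_k)-\eta_y(\nabla g_k-{\bf A}x^{k+1}),$$ $$x_f^{k+1}=x_g^k+\sigma_x(x^{k+1}-x^k),\quad y_f^{k+1}=y_g^k+\sigma_y(y^{k+1}-y^k).$$ **Theorem.** In each of the following four cases there are parameters, depending only on $L_x,L_y,L_{xy},\mu_x,\mu_y,\mu_{xy},\mu_{yx}$, that satisfy the stated bound on $1/(1-\theta)$ and for which the convergence statement below holds with the stated $\omega$: 1. $\mu_x,\mu_y>0$: $\frac1{1-\theta}\le4+4\max\Big\{\sqrt{\frac{L_x}{\mu_x}},\sqrt{\frac{L_y}{\mu_y}},\frac{L_{xy}}{\sqrt{\mu_x\mu_y}}\Big\}$, $\omega=\sqrt{\frac{\mu_y}{\mu_x}}$; 2. $\mu_x,\mu_{xy}>0$: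 $\frac1{1-\theta}\le4+8\max\Big\{\frac{\sqrt{L_xL_y}}{\mu_{xy}},\frac{L_{xy}}{\mu_{xy}}\sqrt{\frac{L_x}{\mu_x}},\frac{L_{xy}^2}{\mu_{xy}^2}\Big\}$, $\omega=\sqrt{\frac{\mu_{xy}^2}{2\mu_xL_x}}$; 3. $\mu_y,\mu_{yx}>0$: $\frac1{1-\theta}\le4+8\max\Big\{\frac{\sqrt{L_xL_y}}{\mu_{yx}},\frac{L_{xy}}{\mu_{yx}}\sqrt{\frac{L_y}{\mu_y}},\frac{L_{xy}^2}{\mu_{yx}^2}\Big\}$, $\omega=\sqrt{\frac{2\mu_yL_y}{\mu_{yx}^2}}$; 4. $\mu_{xy},\mu_{yx}>0$: $\frac1{1-\theta}\le2+8\max\Big\{\frac{\sqrt{L_xL_y}L_{xy}}{\mu_{xy}\mu_{yx}},\frac{L_{xy}^2}{\mu_{yx}^2},\frac{L_{xy}^2}{\mu_{xy}^2}\Big\}$, $\omega=\frac{\mu_{xy}}{\mu_{yx}}\sqrt{\frac{L_y}{L_x}}$. *Convergence statement.* There is a solution $(x^*,y^*)$ such that $x^*\in\operatorname{range}{\bf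 A}^\top$ if all gradients of $f$ lie in $\operatorname{range}{\bf A}^\top$, and $y^*\in\operatorname{range}{\bf A}$ if all gradients of $g$ lie in $\operatorname{range}{\bf A}$; and for every such solution and every $k\ge0$ the following expectations are finite and $$\mathbb E\|x^k-x^*\|^2\le\frac{\omega}{3L_{xy}}\Big(\theta^k\Psi^0+\frac{4(\delta_x+\delta_y)}{(1-\theta)^2}+\frac{\Sigma^2}{2(1-\theta)}\Big),$$ $$\mathbb E\|y^k-y^*\|^2\le\frac{1}{4L_{xy}\omega}\Big(\theta^k\Psi^0+\frac{4(\delta_x+\delta_y)}{(1-\theta)^2}+\frac{\Sigma^2}{2(1-\theta)}\Big),$$ $$\mathbb E\Psi^{k+1}\le\theta\,\mathbb E\Psi^k+\frac{4(\delta_x+\delta_y)}{1-\theta}+\frac{\Sigma^2}2,$$ where $\Sigma^2=\big(\frac1{L_x}+\frac\omega{L_{xy}}\big)\frac{\sigma_f^2}{r_f}+\big(\frac1{L_y}+\frac1{L_{xy}\omega}\big)\frac{\sigma_g^2}{r_g}$ and, with $B_h(u,v)=h(u)-h(v)-\langle\nabla h(v),u-v\rangle$, $$\Psi^k=\tfrac1{\eta_x}\|x^k-x^*\|^2+\tfrac1{\eta_y}\|y^k-y^*\|^2+\tfrac2{\sigma_x}B_f(x_f^k,x^*)+\tfrac2{\sigma_y}B_g(y_f^k,y^*)+\tfrac1{4\eta_y}\|y^k-y^{k-1}\|^2-2\langle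 y^k-y^{k-1},{\bf A}(x^k-x^*)\rangle.$$ Moreover $\Psi^0\le\big(\frac1{\eta_x}+\frac{L_x}{\sigma_x}\big)\|x^0-x^*\|^2+\big(\frac1{\eta_y}+\frac{L_y}{\sigma_y}\big)\|y^0-y^*\|^2$. -/

import Mathlib

open MeasureTheory ProbabilityTheory
open scoped Gradient RealInnerProductSpace Matrix

universe u v

noncomputable section

namespace APDG

/-- The Euclidean space `ℝ^d`. -/
abbrev Vec (d : ℕ) : Type := EuclideanSpace ℝ (Fin d)

/-- The linear map `ℝ^n → ℝ^m` of an `m × n` matrix. -/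
abbrev mulMat {m n : ℕ} (A : Matrix (Fin m) (Fin n) ℝ) : Vec n →ₗ[ℝ] Vec m :=
  Matrix.toEuclideanLin A

/-! ### Functions, inexact models, saddle points -/

/-- `h` is differentiable and its gradient is `L`-Lipschitz. -/
def LSmooth {d : ℕ} (L : ℝ) (h : Vec d → ℝ) : Prop :=
  Differentiable ℝ h ∧ ∀ x y, ‖∇ h y - ∇ h x‖ ≤ L * ‖y - x‖

/-- `μ`-strong convexity of a differentiable function (convexity when `μ = 0`). -/
def MuStronglyConvex {d : ℕ} (μ : ℝ) (h : Vec d → ℝ) : Prop :=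
  Differentiable ℝ h ∧ ∀ x y, h x + ⟪∇ h x, y - x⟫ + μ / 2 * ‖y - x‖ ^ 2 ≤ h y

/-- The vector `s` is a `(δ, L, μ)`-model of `h` at the point `x`. -/
def IsInexactModel {d : ℕ} (h : Vec d → ℝ) (δ L μ : ℝ) (x s : Vec d) : Prop :=
  ∃ c : ℝ, ∀ y, μ / 2 * ‖y - x‖ ^ 2 ≤ h y - (c + ⟪s, y - x⟫) ∧
    h y - (c + ⟪s, y - x⟫) ≤ L / 2 * ‖y - x‖ ^ 2 + δ

/-- The Bregman divergence `B_h(x, z) = h(x) - h(z) - ⟨∇h(z), x - z⟩`. -/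
def bregman {d : ℕ} (h : Vec d → ℝ) (x z : Vec d) : ℝ :=
  h x - h z - ⟪∇ h z, x - z⟫

/-- The objective `f(x) + yᵀ A x - g(y)`. -/
def objective {dx dy : ℕ} (A : Matrix (Fin dy) (Fin dx) ℝ) (f : Vec dx → ℝ) (g : Vec dy → ℝ)
    (x : Vec dx) (y : Vec dy) : ℝ :=
  f x + ⟪y, mulMat A x⟫ - g y

/-- `(xs, ys)` solves `min_x max_y f(x) + yᵀ A x - g(y)`. -/
def IsSolution {dx dy : ℕ} (A : Matrix (Fin dy) (Fin dx) ℝ) (f : Vec dx → ℝ) (g : Vec dy → ℝ)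
    (xs : Vec dx) (ys : Vec dy) : Prop :=
  IsSaddlePointOn Set.univ Set.univ (objective A f g) xs ys

/-! ### Constants of the problem and the coupling matrix -/

/-- Smoothness, strong convexity and coupling constants. -/
structure Constants where
  Lx : ℝ
  Ly : ℝ
  Lxy : ℝ
  μx : ℝ
  μy : ℝ
  μxy : ℝ
  μyx : ℝ

structure Constants.Admissible (c : Constants) : Prop where
  Lx_pos : 0 < c.Lx
  Ly_pos : 0 < c.Ly
  Lxy_pos : 0 < c.Lxy
  μx_nonneg : 0 ≤ c.μx
  μy_nonneg : 0 ≤ c.μy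
  μxy_nonneg : 0 ≤ c.μxy
  μyx_nonneg : 0 ≤ c.μyx

/-- Largest eigenvalue of a symmetric real matrix. -/
def lambdaMax {d : ℕ} (M : Matrix (Fin d) (Fin d) ℝ) : ℝ := sSup (spectrum ℝ M)

/-- Smallest eigenvalue of a symmetric real matrix. -/
def lambdaMin {d : ℕ} (M : Matrix (Fin d) (Fin d) ℝ) : ℝ := sInf (spectrum ℝ M)

/-- Smallest positive eigenvalue of a symmetric real matrix (it is `0` if there is none). -/
def lambdaMinPos {d : ℕ} (M : Matrix (Fin d) (Fin d) ℝ) : ℝ := sInf (spectrum ℝ M ∩ Set.Ioi 0)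

/-! ### The algorithm -/

/-- Parameters of the method. -/
structure Params where
  ηx : ℝ
  ηy : ℝ
  αx : ℝ
  αy : ℝ
  βx : ℝ
  βy : ℝ
  τx : ℝ
  τy : ℝ
  σx : ℝ
  σy : ℝ
  θ : ℝ

/-- The admissible ranges of the parameters. The weight `αx` (`αy`) may vanish only for a function
whose strong convexity constant is `0`. -/
structure Params.Valid (c : Constants) (p : Params) : Prop where
  ηx_pos : 0 < p.ηx
  ηy_pos : 0 < p.ηy
  αx_nonneg : 0 ≤ p.αx
  αy_nonneg : 0 ≤ p.αy
  αx_pos : 0 < c.μx → 0 < p.αx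
  αy_pos : 0 < c.μy → 0 < p.αy
  βx_pos : 0 < p.βx
  βy_pos : 0 < p.βy
  τx_mem : p.τx ∈ Set.Ioc (0 : ℝ) 1
  τy_mem : p.τy ∈ Set.Ioc (0 : ℝ) 1
  σx_mem : p.σx ∈ Set.Ioc (0 : ℝ) 1
  σy_mem : p.σy ∈ Set.Ioc (0 : ℝ) 1
  θ_mem : p.θ ∈ Set.Ioo (0 : ℝ) 1

/-- The variables `x^k, x_f^k, y^k, y_f^k, y^{k-1}` of the method. -/
structure State (dx dy : ℕ) where
  x : Vec dx
  xf : Vec dx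
  y : Vec dy
  yf : Vec dy
  yprev : Vec dy

/-- `x_g^k = τ_x x^k + (1 - τ_x) x_f^k`. -/
def State.xg {dx dy : ℕ} (p : Params) (s : State dx dy) : Vec dx :=
  p.τx • s.x + (1 - p.τx) • s.xf

/-- `y_g^k = τ_y y^k + (1 - τ_y) y_f^k`. -/
def State.yg {dx dy : ℕ} (p : Params) (s : State dx dy) : Vec dy :=
  p.τy • s.y + (1 - p.τy) • s.yf

/-- `x_f^0 = x^0` and `y_f^0 = y^{-1} = y^0`. -/
def State.init {dx dy : ℕ} (x₀ : Vec dx) (y₀ : Vec dy) : State dx dy where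
  x := x₀
  xf := x₀
  y := y₀
  yf := y₀
  yprev := y₀

/-- One iteration, where `gf`, `gg` are the (stochastic, inexact) gradient oracles of `f` and `g`
at this iteration; they are called once, at `x_g^k` and at `y_g^k`. -/
def step {dx dy : ℕ} (p : Params) (A : Matrix (Fin dy) (Fin dx) ℝ)
    (gf : Vec dx → Vec dx) (gg : Vec dy → Vec dy) (s : State dx dy) : State dx dy :=
  let ym := s.y + p.θ • (s.y - s.yprev)
  let xg := s.xg p
  let yg := s.yg p
  let df := gf xg
  let dg := gg yg
  let x' := s.x + (p.ηx * p.αx) • (xg - s.x)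
    - (p.ηx * p.βx) • mulMat Aᵀ (mulMat A s.x - dg) - p.ηx • (df + mulMat Aᵀ ym)
  let y' := s.y + (p.ηy * p.αy) • (yg - s.y)
    - (p.ηy * p.βy) • mulMat A (mulMat Aᵀ s.y + df) - p.ηy • (dg - mulMat A x')
  { x := x'
    xf := xg + p.σx • (x' - s.x)
    y := y'
    yf := yg + p.σy • (y' - s.y)
    yprev := s.y }

/-! ### Stochastic oracles -/

/-- Values of all samples drawn before iteration `k`. The batches have sizes `rf` (for `f`) and
`rg` (for `g`), and all samples take values in `Ξ`. -/
abbrev History (rf rg : ℕ) (Ξ : Type v) (k : ℕ) : Type v :=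
  (Fin k → Fin rf → Ξ) × (Fin k → Fin rg → Ξ)

/-- A stochastic first-order oracle on `ℝ^d`: at iteration `k`, from the samples of the past
iterations, the query point and one fresh sample, it computes a vector. -/
abbrev Oracle (rf rg : ℕ) (Ξ : Type v) (d : ℕ) : Type v :=
  (k : ℕ) → History rf rg Ξ k → Vec d → Ξ → Vec d

/-- Samples drawn before iteration `k`, as a random variable. -/
def history {rf rg : ℕ} {Ω : Type u} {Ξ : Type v} (ξx : ℕ → Fin rf → Ω → Ξ)
    (ξy : ℕ → Fin rg → Ω → Ξ) (k : ℕ) (ω : Ω) : History rf rg Ξ k :=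
  (fun l i => ξx l i ω, fun l j => ξy l j ω)

/-- Average of a family of vectors (a batched gradient). -/
def batchMean {d r : ℕ} (v : Fin r → Vec d) : Vec d := (r : ℝ)⁻¹ • ∑ i, v i

/-- The random iterates of the method. -/
def iterate {dx dy rf rg : ℕ} {Ω : Type u} {Ξ : Type v} (p : Params)
    (A : Matrix (Fin dy) (Fin dx) ℝ) (Gf : Oracle rf rg Ξ dx) (Gg : Oracle rf rg Ξ dy)
    (ξx : ℕ → Fin rf → Ω → Ξ) (ξy : ℕ → Fin rg → Ω → Ξ) (x₀ : Vec dx) (y₀ : Vec dy) :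
    ℕ → Ω → State dx dy
  | 0, _ => State.init x₀ y₀
  | k + 1, ω =>
      step p A
        (fun x => batchMean fun i => Gf k (history ξx ξy k ω) x (ξx k i ω))
        (fun y => batchMean fun j => Gg k (history ξx ξy k ω) y (ξy k j ω))
        (iterate p A Gf Gg ξx ξy x₀ y₀ k ω)

/-- At the point `x`, the random vector `G z`, with `z` of law `law`, is square integrable, its
mean is a `(δ, L, μ)`-model of `h`, and its variance is at most `σ²`. -/
def IsStochasticModel {d : ℕ} {Ξ : Type v} [MeasurableSpace Ξ] (h : Vec d → ℝ) (δ L μ σ : ℝ)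
    (law : Measure Ξ) (G : Ξ → Vec d) (x : Vec d) : Prop :=
  MemLp G 2 law ∧ IsInexactModel h δ L μ x (∫ z, G z ∂law) ∧
    ∫ z, ‖G z - ∫ z', G z' ∂law‖ ^ 2 ∂law ≤ σ ^ 2

/-! ### Assumptions -/

/-- All gradients of `h`, exact and stochastic, lie in the range of `M`. -/
def GradientsInRange {m n rf rg : ℕ} {Ξ : Type v} (M : Matrix (Fin m) (Fin n) ℝ)
    (h : Vec m → ℝ) (G : Oracle rf rg Ξ m) : Prop :=
  (∀ z, ∇ h z ∈ LinearMap.range (mulMat M)) ∧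
    ∀ k H z ζ, G k H z ζ ∈ LinearMap.range (mulMat M)

/-- Assumption on the coupling constants `L_xy`, `μ_xy`, `μ_yx`. -/
structure CouplingAssumption {dx dy rf rg : ℕ} {Ξ : Type v} (c : Constants)
    (A : Matrix (Fin dy) (Fin dx) ℝ) (f : Vec dx → ℝ) (g : Vec dy → ℝ)
    (Gf : Oracle rf rg Ξ dx) (Gg : Oracle rf rg Ξ dy) : Prop where
  Lxy_bound : lambdaMax (Aᵀ * A) ≤ c.Lxy ^ 2
  μxy_bound_pos : GradientsInRange A g Gg → c.μxy ^ 2 ≤ lambdaMinPos (A * Aᵀ)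
  μxy_bound : ¬ GradientsInRange A g Gg → c.μxy ^ 2 ≤ lambdaMin (A * Aᵀ)
  μyx_bound_pos : GradientsInRange Aᵀ f Gf → c.μyx ^ 2 ≤ lambdaMinPos (Aᵀ * A)
  μyx_bound : ¬ GradientsInRange Aᵀ f Gf → c.μyx ^ 2 ≤ lambdaMin (Aᵀ * A)

/-- All samples are independent random variables. -/
structure SamplingAssumption {rf rg : ℕ} {Ω : Type u} {Ξ : Type v} [MeasurableSpace Ω]
    [MeasurableSpace Ξ] (P : Measure Ω) (ξx : ℕ → Fin rf → Ω → Ξ) (ξy : ℕ → Fin rg → Ω → Ξ) :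
    Prop where
  measurable_x : ∀ k i, Measurable (ξx k i)
  measurable_y : ∀ k j, Measurable (ξy k j)
  indep : iIndepFun (Sum.elim (fun q : ℕ × Fin rf => ξx q.1 q.2)
    (fun q : ℕ × Fin rg => ξy q.1 q.2)) P

/-- Assumption on one oracle `G` of `h`: at every iteration `k`, at the point `X k` that the method
queries, and for every sample `ξ k i` of the batch, it is a stochastic `(Δ k, L, μ)`-oracle with
variance at most `σ²`, where the inexactness `Δ k` is a function of the past samples whose
expectation is at most `δ`. -/
structure OracleAssumption {d r rf rg : ℕ} {Ω : Type u} {Ξ : Type v} [MeasurableSpace Ω]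
    [MeasurableSpace Ξ] (P : Measure Ω) (hist : (k : ℕ) → Ω → History rf rg Ξ k)
    (ξ : ℕ → Fin r → Ω → Ξ) (h : Vec d → ℝ) (L μ σ δ : ℝ)
    (Δ : (k : ℕ) → History rf rg Ξ k → ℝ) (G : Oracle rf rg Ξ d) (X : ℕ → Ω → Vec d) :
    Prop where
  measurable : ∀ k, Measurable fun q : History rf rg Ξ k × Vec d × Ξ => G k q.1 q.2.1 q.2.2
  model : ∀ k i, ∀ᵐ ω ∂P, IsStochasticModel h (Δ k (hist k ω)) L μ σ (P.map (ξ k i))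
    (G k (hist k ω) (X k ω)) (X k ω)
  integrable : ∀ k, Integrable (fun ω => Δ k (hist k ω)) P
  mean_le : ∀ k, ∫ ω, Δ k (hist k ω) ∂P ≤ δ

/-! ### The convergence guarantee -/

/-- The Lyapunov function `Ψ^k` of a state, relative to the solution `(xs, ys)`. -/
def lyapunov {dx dy : ℕ} (p : Params) (A : Matrix (Fin dy) (Fin dx) ℝ) (f : Vec dx → ℝ)
    (g : Vec dy → ℝ) (xs : Vec dx) (ys : Vec dy) (s : State dx dy) : ℝ :=
  1 / p.ηx * ‖s.x - xs‖ ^ 2 + 1 / p.ηy * ‖s.y - ys‖ ^ 2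
    + 2 / p.σx * bregman f s.xf xs + 2 / p.σy * bregman g s.yf ys
    + 1 / (4 * p.ηy) * ‖s.y - s.yprev‖ ^ 2 - 2 * ⟪s.y - s.yprev, mulMat A (s.x - xs)⟫

/-- `Σ² = (1/L_x + ω/L_xy) σ_f²/r_f + (1/L_y + 1/(L_xy ω)) σ_g²/r_g`, with `w = ω`. -/
def sigmaSq (c : Constants) (w σf σg : ℝ) (rf rg : ℕ) : ℝ :=
  (1 / c.Lx + w / c.Lxy) * (σf ^ 2 / rf) + (1 / c.Ly + 1 / (c.Lxy * w)) * (σg ^ 2 / rg)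

/-- The common factor `θ^k Ψ⁰ + 4 (δ_x + δ_y) / (1 - θ)² + Σ² / (2 (1 - θ))`. -/
def errorBound (θ Ψ₀ δ S : ℝ) (k : ℕ) : ℝ :=
  θ ^ k * Ψ₀ + 4 / (1 - θ) ^ 2 * δ + S / (2 * (1 - θ))

/-- The solution `(xs, ys)` is the normalised one: a component along which the objective may be
degenerate is taken in the range of the coupling matrix. -/
def IsNormalisedSolution {dx dy rf rg : ℕ} {Ξ : Type v}
    (A : Matrix (Fin dy) (Fin dx) ℝ) (f : Vec dx → ℝ) (g : Vec dy → ℝ)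
    (Gf : Oracle rf rg Ξ dx) (Gg : Oracle rf rg Ξ dy) (xs : Vec dx) (ys : Vec dy) : Prop :=
  IsSolution A f g xs ys ∧
    (GradientsInRange Aᵀ f Gf → xs ∈ LinearMap.range (mulMat Aᵀ)) ∧
    (GradientsInRange A g Gg → ys ∈ LinearMap.range (mulMat A))

/-- With the parameters `p` the method converges, with weight `w = ω`, on every problem that
satisfies the assumptions with constants `c`: for all dimensions, functions, matrices, batch sizes,
inexactness and noise levels, stochastic oracles and starting points. -/
def Converges (c : Constants) (w : ℝ) (p : Params) : Prop :=
  ∀ (dx dy rf rg : ℕ), 0 < dx → 0 < dy → 0 < rf → 0 < rg →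
  ∀ (A : Matrix (Fin dy) (Fin dx) ℝ) (f : Vec dx → ℝ) (g : Vec dy → ℝ),
    MuStronglyConvex c.μx f → LSmooth c.Lx f → MuStronglyConvex c.μy g → LSmooth c.Ly g →
    (∃ xs ys, IsSolution A f g xs ys) →
  ∀ (Ω : Type u) [MeasurableSpace Ω] (P : Measure Ω) [IsProbabilityMeasure P]
    (Ξ : Type v) [MeasurableSpace Ξ] (ξx : ℕ → Fin rf → Ω → Ξ) (ξy : ℕ → Fin rg → Ω → Ξ)
    (Gf : Oracle rf rg Ξ dx) (Gg : Oracle rf rg Ξ dy)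
    (Δx Δy : (k : ℕ) → History rf rg Ξ k → ℝ) (δx δy σf σg : ℝ) (x₀ : Vec dx) (y₀ : Vec dy),
    SamplingAssumption P ξx ξy →
    CouplingAssumption c A f g Gf Gg →
    x₀ ∈ LinearMap.range (mulMat Aᵀ) → y₀ ∈ LinearMap.range (mulMat A) →
    let S : ℕ → Ω → State dx dy := iterate p A Gf Gg ξx ξy x₀ y₀
    OracleAssumption P (history ξx ξy) ξx f c.Lx c.μx σf δx Δx Gf (fun k ω => (S k ω).xg p) →
    OracleAssumption P (history ξx ξy) ξy g c.Ly c.μy σg δy Δy Gg (fun k ω => (S k ω).yg p) →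
    (∃ xs ys, IsNormalisedSolution A f g Gf Gg xs ys) ∧
    ∀ xs ys, IsNormalisedSolution A f g Gf Gg xs ys →
      let Ψ : State dx dy → ℝ := lyapunov p A f g xs ys
      let Ψ₀ : ℝ := Ψ (State.init x₀ y₀)
      let Sig : ℝ := sigmaSq c w σf σg rf rg
      -- `Ψ⁰` is bounded by a polynomial in the initial values
      Ψ₀ ≤ (1 / p.ηx + c.Lx / p.σx) * ‖x₀ - xs‖ ^ 2 + (1 / p.ηy + c.Ly / p.σy) * ‖y₀ - ys‖ ^ 2 ∧
      ∀ k : ℕ,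
        (Integrable (fun ω => ‖(S k ω).x - xs‖ ^ 2) P ∧
          ∫ ω, ‖(S k ω).x - xs‖ ^ 2 ∂P
            ≤ w / (3 * c.Lxy) * errorBound p.θ Ψ₀ (δx + δy) Sig k) ∧
        (Integrable (fun ω => ‖(S k ω).y - ys‖ ^ 2) P ∧
          ∫ ω, ‖(S k ω).y - ys‖ ^ 2 ∂P
            ≤ 1 / (4 * c.Lxy * w) * errorBound p.θ Ψ₀ (δx + δy) Sig k) ∧
        -- the Lyapunov function contracts by `θ` up to the error of one iteration
        (Integrable (fun ω => Ψ (S k ω)) P ∧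
          ∫ ω, Ψ (S (k + 1) ω) ∂P
            ≤ p.θ * ∫ ω, Ψ (S k ω) ∂P + 4 / (1 - p.θ) * (δx + δy) + Sig / 2)

end APDG

end

/-!
# Linear convergence of the inexact stochastic accelerated primal-dual gradient method

The Lyapunov function `Ψ` satisfies, path by path,
`Ψ(next state) ≤ θ Ψ(state) + 4 / (1 - θ) (Δx + Δy) + noise`
(`Params.Contracting.lyapunov_step_le`). Each of the two blocks of an iteration is an accelerated
gradient step, estimated in `block_estimate`: the four-point identity for inner products treats the
pull towards the query point and the augmented term `Aᵀ (A x - ∇g)`, and the relation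
`1 / τ = 1 / σ + 1 / 2` makes the Bregman divergence at the query point appear with coefficient `-1`
(`IsInexactModel.coupling`). That divergence pays for the gradient of this function inside the
augmented term of the *other* block, by co-coercivity of inexact models
(`IsInexactModel.norm_sub_gradient_sq_le`). The bilinear terms of the two blocks combine, thanks to
the extrapolation of `y`, into the inner products in `Ψ` and a remainder absorbed by Young's
inequality. What contracts the distance `‖x - x*‖²` is either strong convexity or the bound
`‖A (x - x*)‖² ≥ μ_yx² ‖x - x*‖²`; the latter needs `x - x*` in the range of `Aᵀ` when only the
positive spectrum is controlled, which holds because the iteration never leaves that range and the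
solution is normalised accordingly (`exists_isNormalisedSolution`).

The new iterates are affine in the gradient noise, so the noise term of an iteration is at most
(`noise_le_noiseTerm`) a sum of inner products of gradient noises with functions of the
past, an inner product of the two independent gradient noises, and squares. By independence and
Fubini's theorem only the squares survive in expectation, and averaging over a batch divides them by
its size (`IsBatch.integral_inner_history`, `IsBatch.integral_inner_sample`,
`IsBatch.integral_norm_sq_le`). Unrolling the recursion, and `Ψ ≥ 3 L_xy / ω ‖x - x*‖² +
4 L_xy ω ‖y - y*‖²`, give the convergence statement for all parameters subject to the inequalities
`Params.Contracting`.

For the rates, let `N` be the claimed bound on `1 / (1 - θ)` and take `σ = 2 / N`. A block contracts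
at rate `1 / N` with `η = 1 / (μ N)`, `α = μ` if its function is strongly convex
(`BlockStep.of_stronglyConvex`), or with `η = 2 L' / (ν² N)` if its coupling constant `ν` is
positive (`BlockStep.of_coupling`, with `L'` the smoothness of the other function). In the latter
situation one needs that `ν` is at most `L_xy`, and otherwise no problem satisfies the assumptions.
-/

namespace APDG

/-! ### The coupling matrix and its spectrum -/

section LinearAlgebra

variable {m n : ℕ}

/-- Multiplication by `Aᵀ` is adjoint to multiplication by `A`. -/
lemma inner_mulMat (A : Matrix (Fin m) (Fin n) ℝ) (x : Vec n) (y : Vec m) :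
    ⟪mulMat A x, y⟫ = ⟪x, mulMat Aᵀ y⟫ := by
  have h := Matrix.toEuclideanLin_conjTranspose_eq_adjoint A
  rw [Matrix.conjTranspose_eq_transpose_of_trivial] at h
  rw [mulMat, mulMat, h, LinearMap.adjoint_inner_right]

lemma norm_mulMat_sq (A : Matrix (Fin m) (Fin n) ℝ) (x : Vec n) :
    ‖mulMat A x‖ ^ 2 = ⟪x, mulMat (Aᵀ * A) x⟫ := by
  rw [← real_inner_self_eq_norm_sq, inner_mulMat]
  simp [mulMat, Matrix.toLpLin_apply]

lemma isHermitian_transpose_mul (A : Matrix (Fin m) (Fin n) ℝ) : (Aᵀ * A).IsHermitian := by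
  rw [← Matrix.conjTranspose_eq_transpose_of_trivial]
  exact Matrix.isHermitian_conjTranspose_mul_self A

lemma mulMat_eigenvectorBasis (A : Matrix (Fin m) (Fin n) ℝ) (i : Fin n) :
    mulMat (Aᵀ * A) ((isHermitian_transpose_mul A).eigenvectorBasis i) =
      (isHermitian_transpose_mul A).eigenvalues i •
        (isHermitian_transpose_mul A).eigenvectorBasis i := by
  have h := (isHermitian_transpose_mul A).mulVec_eigenvectorBasis i
  rw [mulMat, Matrix.toLpLin_apply, h]
  rfl

lemma norm_mulMat_eigenvectorBasis (A : Matrix (Fin m) (Fin n) ℝ) (i : Fin n) :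
    ‖mulMat A ((isHermitian_transpose_mul A).eigenvectorBasis i)‖ ^ 2 =
      (isHermitian_transpose_mul A).eigenvalues i := by
  rw [norm_mulMat_sq, mulMat_eigenvectorBasis, real_inner_smul_right, real_inner_self_eq_norm_sq]
  simp

/-- `‖A x‖²` in an eigenbasis of `Aᵀ A`. -/
lemma norm_mulMat_sq_eq_sum (A : Matrix (Fin m) (Fin n) ℝ) (x : Vec n) :
    ‖mulMat A x‖ ^ 2 = ∑ i, (isHermitian_transpose_mul A).eigenvalues i *
      ⟪(isHermitian_transpose_mul A).eigenvectorBasis i, x⟫ ^ 2 := by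
  set b := (isHermitian_transpose_mul A).eigenvectorBasis
  rw [norm_mulMat_sq, ← b.sum_inner_mul_inner]
  refine Finset.sum_congr rfl fun i _ => ?_
  have h : ⟪b i, mulMat (Aᵀ * A) x⟫ = (isHermitian_transpose_mul A).eigenvalues i * ⟪b i, x⟫ := by
    have e : mulMat (Aᵀ * A) = mulMat (Aᵀ * A)ᵀ := by
      rw [Matrix.transpose_mul, Matrix.transpose_transpose]
    rw [e, ← inner_mulMat, mulMat_eigenvectorBasis, real_inner_smul_left]
  rw [h, real_inner_comm]
  ring

lemma norm_sq_eq_sum (A : Matrix (Fin m) (Fin n) ℝ) (x : Vec n) :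
    ‖x‖ ^ 2 = ∑ i, ⟪(isHermitian_transpose_mul A).eigenvectorBasis i, x⟫ ^ 2 := by
  set b := (isHermitian_transpose_mul A).eigenvectorBasis
  rw [← real_inner_self_eq_norm_sq, ← b.sum_inner_mul_inner]
  exact Finset.sum_congr rfl fun i _ => by rw [real_inner_comm]; ring

lemma norm_mulMat_sq_le (A : Matrix (Fin m) (Fin n) ℝ) (x : Vec n) :
    ‖mulMat A x‖ ^ 2 ≤ lambdaMax (Aᵀ * A) * ‖x‖ ^ 2 := by
  rw [norm_mulMat_sq_eq_sum, norm_sq_eq_sum A, Finset.mul_sum]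
  refine Finset.sum_le_sum fun i _ => mul_le_mul_of_nonneg_right ?_ (sq_nonneg _)
  exact le_csSup (Matrix.finite_real_spectrum).bddAbove
    ((isHermitian_transpose_mul A).eigenvalues_mem_spectrum_real i)

lemma le_norm_mulMat_sq (A : Matrix (Fin m) (Fin n) ℝ) (x : Vec n) :
    lambdaMin (Aᵀ * A) * ‖x‖ ^ 2 ≤ ‖mulMat A x‖ ^ 2 := by
  rw [norm_mulMat_sq_eq_sum, norm_sq_eq_sum A, Finset.mul_sum]
  refine Finset.sum_le_sum fun i _ => mul_le_mul_of_nonneg_right ?_ (sq_nonneg _)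
  exact csInf_le (Matrix.finite_real_spectrum).bddBelow
    ((isHermitian_transpose_mul A).eigenvalues_mem_spectrum_real i)

/-- On the range of `Aᵀ`, which is orthogonal to the kernel of `A`, only the positive eigenvalues
of `Aᵀ A` matter. -/
lemma le_norm_mulMat_sq_of_mem_range (A : Matrix (Fin m) (Fin n) ℝ) {x : Vec n}
    (hx : x ∈ LinearMap.range (mulMat Aᵀ)) :
    lambdaMinPos (Aᵀ * A) * ‖x‖ ^ 2 ≤ ‖mulMat A x‖ ^ 2 := by
  obtain ⟨w, rfl⟩ := hx
  rw [norm_mulMat_sq_eq_sum A (mulMat Aᵀ w), norm_sq_eq_sum A, Finset.mul_sum]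
  refine Finset.sum_le_sum fun i _ => ?_
  have hn := norm_mulMat_eigenvectorBasis A i
  rcases (hn ▸ sq_nonneg _ : 0 ≤ (isHermitian_transpose_mul A).eigenvalues i).eq_or_lt with h | h
  · rw [← h] at hn
    have h0 : mulMat A ((isHermitian_transpose_mul A).eigenvectorBasis i) = 0 :=
      norm_eq_zero.1 (pow_eq_zero_iff two_ne_zero |>.1 hn)
    rw [← inner_mulMat, h0]
    simp
  · refine mul_le_mul_of_nonneg_right ?_ (sq_nonneg _)
    exact csInf_le ((Matrix.finite_real_spectrum).inter_of_left _).bddBelow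
      ⟨(isHermitian_transpose_mul A).eigenvalues_mem_spectrum_real i, h⟩

lemma norm_mulMat_le {L : ℝ} (hL : 0 < L) {A : Matrix (Fin m) (Fin n) ℝ}
    (h : lambdaMax (Aᵀ * A) ≤ L ^ 2) (x : Vec n) : ‖mulMat A x‖ ≤ L * ‖x‖ := by
  refine abs_le_of_sq_le_sq' ?_ (by positivity) |>.2
  rw [mul_pow]
  exact (norm_mulMat_sq_le A x).trans (by gcongr)

lemma norm_mulMat_transpose_le {L : ℝ} (hL : 0 < L) {A : Matrix (Fin m) (Fin n) ℝ}
    (h : lambdaMax (Aᵀ * A) ≤ L ^ 2) (y : Vec m) : ‖mulMat Aᵀ y‖ ≤ L * ‖y‖ := by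
  rcases (norm_nonneg (mulMat Aᵀ y)).eq_or_lt with h0 | h0
  · rw [← h0]; positivity
  refine le_of_mul_le_mul_left ?_ h0
  calc ‖mulMat Aᵀ y‖ * ‖mulMat Aᵀ y‖ = ⟪mulMat A (mulMat Aᵀ y), y⟫ := by
        rw [inner_mulMat, real_inner_self_eq_norm_mul_norm]
    _ ≤ ‖mulMat A (mulMat Aᵀ y)‖ * ‖y‖ := real_inner_le_norm _ _
    _ ≤ L * ‖mulMat Aᵀ y‖ * ‖y‖ := by gcongr; exact norm_mulMat_le hL h _
    _ = ‖mulMat Aᵀ y‖ * (L * ‖y‖) := by ring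

/-- The coupling bound for vectors `x` that lie in the range of `Aᵀ` whenever only the positive
spectrum of `Aᵀ A` is bounded below; `p` tells which of the two readings applies. -/
lemma sq_mul_norm_sq_le {μ : ℝ} (A : Matrix (Fin m) (Fin n) ℝ) {p : Prop}
    (hpos : p → μ ^ 2 ≤ lambdaMinPos (Aᵀ * A)) (hneg : ¬ p → μ ^ 2 ≤ lambdaMin (Aᵀ * A))
    {x : Vec n} (hx : p → x ∈ LinearMap.range (mulMat Aᵀ)) :
    μ ^ 2 * ‖x‖ ^ 2 ≤ ‖mulMat A x‖ ^ 2 := by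
  by_cases h : p
  · exact (by gcongr; exact hpos h : _ ≤ _).trans (le_norm_mulMat_sq_of_mem_range A (hx h))
  · exact (by gcongr; exact hneg h : _ ≤ _).trans (le_norm_mulMat_sq A x)

/-- A positive lower bound on the spectrum of `Aᵀ A`, in either reading, is at most any upper
bound on the norm of `A`. -/
lemma le_of_spectrum_bounds {μ L : ℝ} (hμ : 0 < μ) (hn : 0 < n)
    (A : Matrix (Fin m) (Fin n) ℝ) {p : Prop} (hA : ∀ x, ‖mulMat A x‖ ≤ L * ‖x‖)
    (hpos : p → μ ^ 2 ≤ lambdaMinPos (Aᵀ * A)) (hneg : ¬ p → μ ^ 2 ≤ lambdaMin (Aᵀ * A)) :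
    μ ≤ L := by
  obtain ⟨i, hi⟩ : ∃ i, μ ^ 2 ≤ (isHermitian_transpose_mul A).eigenvalues i := by
    have hspec := (isHermitian_transpose_mul A).spectrum_real_eq_range_eigenvalues
    by_cases h : p
    · have h1 := hpos h
      have hne : (spectrum ℝ (Aᵀ * A) ∩ Set.Ioi 0).Nonempty := by
        by_contra hne
        rw [Set.not_nonempty_iff_eq_empty] at hne
        rw [lambdaMinPos, hne, Real.sInf_empty] at h1
        exact (h1.trans_lt (pow_pos hμ 2)).false
      obtain ⟨t, ht⟩ := hne
      obtain ⟨i, rfl⟩ := hspec ▸ ht.1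
      exact ⟨i, h1.trans (csInf_le ((Matrix.finite_real_spectrum).inter_of_left _).bddBelow ht)⟩
    · exact ⟨⟨0, hn⟩, (hneg h).trans (csInf_le (Matrix.finite_real_spectrum).bddBelow
        ((isHermitian_transpose_mul A).eigenvalues_mem_spectrum_real _))⟩
  rw [← norm_mulMat_eigenvectorBasis] at hi
  have h := abs_le_of_sq_le_sq' hi (norm_nonneg _) |>.2
  simpa using h.trans (hA _)

end LinearAlgebra

/-! ### Convex smooth functions and their inexact models -/

section Functions

variable {d : ℕ} {h : Vec d → ℝ} {L μ δ : ℝ}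

lemma bregman_nonneg (hμ : 0 ≤ μ) (hc : MuStronglyConvex μ h) (x z : Vec d) :
    0 ≤ bregman h x z := by
  have h1 := hc.2 z x
  have : 0 ≤ μ / 2 * ‖x - z‖ ^ 2 := by positivity
  unfold bregman
  linarith

lemma hasDerivAt_comp_line (hd : Differentiable ℝ h) (x v : Vec d) (t : ℝ) :
    HasDerivAt (fun t : ℝ => h (x + t • v)) ⟪∇ h (x + t • v), v⟫ t := by
  have hl : HasDerivAt (fun t : ℝ => x + t • v) v t := by
    simpa using ((hasDerivAt_id t).smul_const v).const_add x
  have h1 := (hd (x + t • v)).hasGradientAt.hasFDerivAt.comp_hasDerivAt t hl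
  exact h1.congr_deriv (by simp)

/-- The descent lemma. -/
lemma bregman_le (hs : LSmooth L h) (x z : Vec d) :
    bregman h x z ≤ L / 2 * ‖x - z‖ ^ 2 := by
  set v := x - z
  let φ : ℝ → ℝ := fun t => h (z + t • v) - h z - t * ⟪∇ h z, v⟫ - L / 2 * t ^ 2 * ‖v‖ ^ 2
  have hφ : ∀ t, HasDerivAt φ (⟪∇ h (z + t • v), v⟫ - ⟪∇ h z, v⟫ - L * t * ‖v‖ ^ 2) t := by
    intro t
    have h2 := (((hasDerivAt_comp_line hs.1 z v t).sub_const (h z)).sub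
      ((hasDerivAt_id t).mul_const ⟪∇ h z, v⟫)).sub
      ((((hasDerivAt_id t).pow 2).const_mul (L / 2)).mul_const (‖v‖ ^ 2))
    refine h2.congr_deriv ?_
    simp only [id_eq, Nat.cast_ofNat, Nat.add_one_sub_one, pow_one]
    ring
  have hanti : AntitoneOn φ (Set.Icc 0 1) := by
    refine antitoneOn_of_deriv_nonpos (convex_Icc _ _)
      (fun t _ => (hφ t).continuousAt.continuousWithinAt)
      (fun t _ => (hφ t).differentiableAt.differentiableWithinAt) fun t ht => ?_
    rw [interior_Icc] at ht
    rw [(hφ t).deriv, ← inner_sub_left]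
    have h1 := hs.2 z (z + t • v)
    rw [add_sub_cancel_left, norm_smul, Real.norm_of_nonneg ht.1.le] at h1
    have h2 := (real_inner_le_norm (∇ h (z + t • v) - ∇ h z) v).trans
      (mul_le_mul_of_nonneg_right h1 (norm_nonneg v))
    linarith
  have h01 := hanti (Set.left_mem_Icc.2 zero_le_one) (Set.right_mem_Icc.2 zero_le_one) zero_le_one
  simp only [φ, v, zero_smul, add_zero, one_smul, add_sub_cancel] at h01
  unfold bregman
  linarith

lemma continuous_bregman (hs : LSmooth L h) (z : Vec d) : Continuous fun x => bregman h x z := by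
  unfold bregman
  have := hs.1.continuous
  fun_prop

lemma IsInexactModel.nonneg {x s : Vec d} (hm : IsInexactModel h δ L μ x s) : 0 ≤ δ := by
  obtain ⟨c, hc⟩ := hm
  have := hc x
  simp at this
  linarith

/-- The models at a point form a convex set. -/
lemma IsInexactModel.batchMean {r : ℕ} (hr : 0 < r) {x : Vec d} {s : Fin r → Vec d}
    (hm : ∀ i, IsInexactModel h δ L μ x (s i)) : IsInexactModel h δ L μ x (batchMean s) := by
  choose c hc using hm
  have hr' : (0 : ℝ) < r := by exact_mod_cast hr
  refine ⟨(r : ℝ)⁻¹ * ∑ i, c i, fun y => ?_⟩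
  have e : h y - ((r : ℝ)⁻¹ * ∑ i, c i + ⟪APDG.batchMean s, y - x⟫) =
      (r : ℝ)⁻¹ * ∑ i, (h y - (c i + ⟪s i, y - x⟫)) := by
    simp only [APDG.batchMean, real_inner_smul_left, sum_inner, Finset.sum_sub_distrib,
      Finset.sum_add_distrib, Finset.sum_const, Finset.card_univ, Fintype.card_fin, nsmul_eq_mul]
    field_simp
  rw [e]
  constructor
  · rw [le_inv_mul_iff₀ hr']
    simpa using Finset.sum_le_sum fun i (_ : i ∈ Finset.univ) => (hc i y).1
  · rw [inv_mul_le_iff₀ hr']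
    simpa [mul_add] using Finset.sum_le_card_nsmul _ _ _
      fun i (_ : i ∈ Finset.univ) => (hc i y).2

lemma IsInexactModel.bregman_le {x s : Vec d} (hm : IsInexactModel h δ L μ x s) (z v : Vec d) :
    bregman h v z ≤ bregman h x z + ⟪s - ∇ h z, v - x⟫ + L / 2 * ‖v - x‖ ^ 2 + δ := by
  obtain ⟨c, hc⟩ := hm
  have h1 := (hc v).2
  have h2 := (hc x).1
  simp only [sub_self, norm_zero, inner_zero_right] at h2
  have e : ⟪∇ h z, v - z⟫ = ⟪∇ h z, v - x⟫ + ⟪∇ h z, x - z⟫ := by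
    rw [← inner_add_right, sub_add_sub_cancel]
  unfold bregman
  rw [inner_sub_left, e]
  linarith

lemma IsInexactModel.le_bregman {x s : Vec d} (hm : IsInexactModel h δ L μ x s) (z v : Vec d) :
    bregman h x z + ⟪s - ∇ h z, v - x⟫ + μ / 2 * ‖v - x‖ ^ 2 ≤ bregman h v z + δ := by
  obtain ⟨c, hc⟩ := hm
  have h1 := (hc v).1
  have h2 := (hc x).2
  simp only [sub_self, norm_zero, inner_zero_right] at h2
  have e : ⟪∇ h z, v - z⟫ = ⟪∇ h z, v - x⟫ + ⟪∇ h z, x - z⟫ := by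
    rw [← inner_add_right, sub_add_sub_cancel]
  unfold bregman
  rw [inner_sub_left, e]
  linarith

/-- Inexact co-coercivity: minimise the upper model of the Bregman divergence over the point. -/
lemma IsInexactModel.norm_sub_gradient_sq_le (hL : 0 < L) (hμ : 0 ≤ μ)
    (hc : MuStronglyConvex μ h) {x s : Vec d} (hm : IsInexactModel h δ L μ x s) (z : Vec d) :
    ‖s - ∇ h z‖ ^ 2 ≤ 2 * L * (bregman h x z + δ) := by
  have h1 := hm.bregman_le z (x - L⁻¹ • (s - ∇ h z))
  have h0 := bregman_nonneg hμ hc (x - L⁻¹ • (s - ∇ h z)) z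
  rw [sub_sub_cancel_left, inner_neg_right, real_inner_smul_right, real_inner_self_eq_norm_sq,
    norm_neg, norm_smul, Real.norm_of_nonneg (inv_nonneg.2 hL.le)] at h1
  have e : L / 2 * (L⁻¹ * ‖s - ∇ h z‖) ^ 2 = L⁻¹ * ‖s - ∇ h z‖ ^ 2 / 2 := by field_simp
  have h2 : L⁻¹ * ‖s - ∇ h z‖ ^ 2 ≤ 2 * (bregman h x z + δ) := by linarith
  rw [inv_mul_le_iff₀ hL] at h2
  linarith

/-- If all gradients of `h` lie in the range of `M`, then `h` is constant along the orthogonal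
complement of that range. -/
lemma eq_of_gradient_mem {n : ℕ} {M : Matrix (Fin d) (Fin n) ℝ} (hd : Differentiable ℝ h)
    (hg : ∀ z, ∇ h z ∈ LinearMap.range (mulMat M)) {v : Vec d} (hv : mulMat Mᵀ v = 0)
    (x : Vec d) : h (x + v) = h x := by
  have hφ : ∀ t : ℝ, HasDerivAt (fun t : ℝ => h (x + t • v)) 0 t := by
    intro t
    obtain ⟨w, hw⟩ := hg (x + t • v)
    refine (hasDerivAt_comp_line hd x v t).congr_deriv ?_
    rw [← hw, inner_mulMat, hv, inner_zero_right]
  have := is_const_of_deriv_eq_zero (fun t => (hφ t).differentiableAt) (fun t => (hφ t).deriv) 1 0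
  simpa using this

end Functions

/-! ### Saddle points -/

section Saddle

variable {dx dy rf rg : ℕ} {A : Matrix (Fin dy) (Fin dx) ℝ} {f : Vec dx → ℝ} {g : Vec dy → ℝ}

lemma gradient_eq_of_forall_le {d : ℕ} {h : Vec d → ℝ} (hd : Differentiable ℝ h) {z s : Vec d}
    (hmin : ∀ x, h z - ⟪s, z⟫ ≤ h x - ⟪s, x⟫) : ∇ h z = s := by
  have h1 : HasFDerivAt (fun x => h x - ⟪s, x⟫) (innerSL ℝ (∇ h z) - innerSL ℝ s) z :=
    (hd z).hasGradientAt.hasFDerivAt.sub (innerSL ℝ s).hasFDerivAt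
  have h2 := (IsLocalMin.hasFDerivAt_eq_zero (Filter.Eventually.of_forall hmin) h1)
  rw [← map_sub] at h2
  have h3 := congrArg (fun l => l (∇ h z - s)) h2
  simp only [innerSL_apply_apply, zero_apply, inner_self_eq_zero] at h3
  exact sub_eq_zero.1 h3

lemma IsSolution.gradient_f (hf : Differentiable ℝ f) {xs : Vec dx} {ys : Vec dy}
    (h : IsSolution A f g xs ys) : ∇ f xs = - mulMat Aᵀ ys := by
  refine gradient_eq_of_forall_le hf fun x => ?_
  have := h x trivial ys trivial
  simp only [objective, real_inner_comm _ ys, inner_mulMat] at this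
  simp only [inner_neg_left, real_inner_comm _ (mulMat Aᵀ ys)] at *
  linarith

lemma IsSolution.gradient_g (hg : Differentiable ℝ g) {xs : Vec dx} {ys : Vec dy}
    (h : IsSolution A f g xs ys) : ∇ g ys = mulMat A xs := by
  refine gradient_eq_of_forall_le hg fun y => ?_
  have := h xs trivial y trivial
  simp only [objective] at this
  simp only [real_inner_comm _ (mulMat A xs)] at *
  linarith

/-- Any vector differs from some vector of the range of `Mᵀ` by an element of the kernel of `M`. -/
lemma exists_mem_range_transpose {m n : ℕ} (M : Matrix (Fin m) (Fin n) ℝ) (x : Vec n) :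
    ∃ v, mulMat M v = 0 ∧ x + v ∈ LinearMap.range (mulMat Mᵀ) := by
  let K := LinearMap.range (mulMat Mᵀ)
  refine ⟨K.starProjection x - x, ?_, by simp [K]⟩
  have h1 := Submodule.sub_starProjection_mem_orthogonal (K := K) x
  rw [← inner_self_eq_zero (𝕜 := ℝ), inner_mulMat, ← neg_sub x, inner_neg_left, neg_eq_zero,
    real_inner_comm]
  exact h1 _ ⟨_, rfl⟩

/-- Projecting a solution onto the ranges of `Aᵀ` and `A` where the gradients lie there keeps the
objective, hence gives a normalised solution. -/
lemma exists_isNormalisedSolution {Ξ : Type v} {Gf : Oracle rf rg Ξ dx} {Gg : Oracle rf rg Ξ dy}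
    (hf : Differentiable ℝ f) (hg : Differentiable ℝ g) (h : ∃ xs ys, IsSolution A f g xs ys) :
    ∃ xs ys, IsNormalisedSolution A f g Gf Gg xs ys := by
  obtain ⟨xs, ys, h⟩ := h
  obtain ⟨v, hv, hfv⟩ : ∃ v, (mulMat A v = 0 ∧ ∀ x, f (x + v) = f x) ∧
      (GradientsInRange Aᵀ f Gf → xs + v ∈ LinearMap.range (mulMat Aᵀ)) := by
    by_cases hG : GradientsInRange Aᵀ f Gf
    · obtain ⟨v, hv, hm⟩ := exists_mem_range_transpose A xs
      exact ⟨v, ⟨hv, eq_of_gradient_mem hf hG.1 (by simpa using hv)⟩, fun _ => hm⟩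
    · exact ⟨0, by simp, fun h => (hG h).elim⟩
  obtain ⟨w, hw, hgw⟩ : ∃ w, (mulMat Aᵀ w = 0 ∧ ∀ y, g (y + w) = g y) ∧
      (GradientsInRange A g Gg → ys + w ∈ LinearMap.range (mulMat A)) := by
    by_cases hG : GradientsInRange A g Gg
    · obtain ⟨w, hw, hm⟩ := exists_mem_range_transpose Aᵀ ys
      rw [Matrix.transpose_transpose] at hm
      exact ⟨w, ⟨hw, eq_of_gradient_mem hg hG.1 hw⟩, fun _ => hm⟩
    · exact ⟨0, by simp, fun h => (hG h).elim⟩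
  have ey : ∀ x y, objective A f g x (y + w) = objective A f g x y := by
    intro x y
    have : ⟪w, mulMat A x⟫ = 0 := by rw [real_inner_comm, inner_mulMat, hw.1, inner_zero_right]
    simp only [objective, hw.2, inner_add_left, this, add_zero]
  have ex : ∀ x y, objective A f g (x + v) y = objective A f g x y := by
    intro x y
    simp only [objective, hv.2, map_add, hv.1, add_zero]
  refine ⟨xs + v, ys + w, fun x hx y hy => ?_, hfv, hgw⟩
  rw [ey, ex]
  exact h x hx y hy

end Saddle

/-! ### One iteration, path by path -/

/-- The inequalities between the parameters under which the method contracts; `w` is the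
weight `ω` between the two blocks. The weights `αx`, `αy` may be smaller than the strong convexity
constants. -/
structure Params.Contracting (c : Constants) (w : ℝ) (p : Params) : Prop where
  w_pos : 0 < w
  αx_le : p.αx ≤ c.μx
  αy_le : p.αy ≤ c.μy
  τx_eq : p.τx = (1 / p.σx + 1 / 2)⁻¹
  τy_eq : p.τy = (1 / p.σy + 1 / 2)⁻¹
  ηx_smooth : p.ηx * (p.αx + c.Lx * p.σx) ≤ 1 / 4
  ηy_smooth : p.ηy * (p.αy + c.Ly * p.σy) ≤ 1 / 4
  ηx_coupling : p.ηx ≤ w / (4 * c.Lxy)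
  ηy_coupling : p.ηy ≤ 1 / (4 * c.Lxy * w)
  βx_smooth : p.βx * (2 * c.Ly) ≤ 1
  βy_smooth : p.βy * (2 * c.Lx) ≤ 1
  βx_coupling : p.βx * p.ηx * c.Lxy ^ 2 ≤ 1 / 2
  βy_coupling : p.βy * p.ηy * c.Lxy ^ 2 ≤ 1 / 2
  θ_σx : 1 - p.θ ≤ p.σx / 2
  θ_σy : 1 - p.θ ≤ p.σy / 2
  θ_x : 1 - p.θ ≤ p.ηx * (p.αx + p.βx * c.μyx ^ 2)
  θ_y : 1 - p.θ ≤ p.ηy * (p.αy + p.βy * c.μxy ^ 2)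

section Block

variable {m n : ℕ} {h : Vec n → ℝ} {L μ δ : ℝ}

lemma two_mul_inner_sub_sub {d : ℕ} (a b c e : Vec d) :
    2 * ⟪a - b, c - e⟫ = ‖a - e‖ ^ 2 - ‖a - c‖ ^ 2 + ‖b - c‖ ^ 2 - ‖b - e‖ ^ 2 := by
  simp only [norm_sub_sq_real, inner_sub_left, inner_sub_right]
  ring

/-- The accelerated (linear coupling) estimate: the choice `1 / τ = 1 / σ + 1 / 2` leaves the
Bregman divergence at the query point with coefficient `-1`. -/
lemma IsInexactModel.coupling (hμ : 0 ≤ μ) {σ τ : ℝ} (hσ : σ ∈ Set.Ioc (0 : ℝ) 1)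
    (hτ : τ = (1 / σ + 1 / 2)⁻¹) {x x' xf xg xf' xs s : Vec n}
    (hxg : xg = τ • x + (1 - τ) • xf) (hxf' : xf' = xg + σ • (x' - x))
    (hm : IsInexactModel h δ L μ xg s) :
    2 / σ * bregman h xf' xs ≤ (2 / σ - 1) * bregman h xf xs - bregman h xg xs
      + L * σ * ‖x' - x‖ ^ 2 - μ * ‖xg - xs‖ ^ 2 + 2 * ⟪s - ∇ h xs, x' - xs⟫
      + (4 / σ + 1) * δ := by
  obtain ⟨h0, h1⟩ := hσ
  have hσ' : 1 ≤ 1 / σ := by rwa [le_div_iff₀ h0, one_mul]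
  have hτ0 : 0 < τ := by rw [hτ]; positivity
  have hτ' : (1 - τ) / τ = 1 / σ - 1 / 2 := by
    rw [sub_div, div_self hτ0.ne', hτ, div_inv_eq_mul]
    ring
  set s' := s - ∇ h xs
  have e1 : xf' - xg = σ • (x' - x) := by rw [hxf', add_sub_cancel_left]
  have e2 : x - xg = (1 / σ - 1 / 2) • (xg - xf) := by
    rw [← hτ', ← sub_eq_zero]
    have : τ • ((x - xg) - ((1 - τ) / τ) • (xg - xf)) = 0 := by
      rw [smul_sub, smul_smul, mul_div_cancel₀ _ hτ0.ne', hxg]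
      module
    exact (smul_eq_zero.1 this).resolve_left hτ0.ne'
  have b1 := hm.bregman_le xs xf'
  have b2 := hm.le_bregman xs xf
  have b3 := hm.le_bregman xs xs
  rw [e1, real_inner_smul_right, norm_smul, Real.norm_of_nonneg h0.le] at b1
  have b4 : bregman h xs xs = 0 := by simp [bregman]
  have e3 : ⟪s', x' - xs⟫ = ⟪s', x' - x⟫ - (1 / σ - 1 / 2) * ⟪s', xf - xg⟫ - ⟪s', xs - xg⟫ := by
    have : x' - xs = (x' - x) + (x - xg) - (xs - xg) := by abel
    rw [this, e2, inner_sub_right, inner_add_right, real_inner_smul_right, ← neg_sub xf xg,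
      inner_neg_right]
    ring
  have b2' : bregman h xg xs + ⟪s', xf - xg⟫ ≤ bregman h xf xs + δ := by
    have : 0 ≤ μ / 2 * ‖xf - xg‖ ^ 2 := by positivity
    linarith
  rw [b4, norm_sub_rev xs xg] at b3
  have c1 := mul_le_mul_of_nonneg_left b1 (by positivity : 0 ≤ 2 / σ)
  have c2 := mul_le_mul_of_nonneg_left b2' (by linarith : 0 ≤ 2 * (1 / σ - 1 / 2))
  have c1' : 2 / σ * (bregman h xg xs + σ * ⟪s', x' - x⟫ + L / 2 * (σ * ‖x' - x‖) ^ 2 + δ) =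
      2 / σ * bregman h xg xs + 2 * ⟪s', x' - x⟫ + L * σ * ‖x' - x‖ ^ 2 + 2 / σ * δ := by
    field_simp
  rw [c1'] at c1
  rw [e3]
  have e4 : 2 / σ = 2 * (1 / σ) := by ring
  have e5 : 4 / σ = 4 * (1 / σ) := by ring
  rw [e4] at c1 ⊢
  rw [e5]
  linarith

/-- The estimate for one of the two blocks of an iteration. Here `s + e` is the stochastic gradient,
`G` the stochastic gradient of the other function (up to sign), and `r` the coupling term. -/
lemma block_estimate (hμ : 0 ≤ μ) {η α β σ τ K : ℝ} (hη : 0 < η) (hα : 0 ≤ α)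
    (hαμ : α ≤ μ) (hβ : 0 ≤ β) (hσ : σ ∈ Set.Ioc (0 : ℝ) 1) (hτ : τ = (1 / σ + 1 / 2)⁻¹)
    (hsmooth : η * (α + L * σ) ≤ 1 / 4) (hcoup : β * η * K ^ 2 ≤ 1 / 2)
    {B : Matrix (Fin m) (Fin n) ℝ} (hB : ∀ v, ‖mulMat B v‖ ≤ K * ‖v‖)
    {x x' xf xg xf' xs s e r : Vec n} {G : Vec m}
    (hxg : xg = τ • x + (1 - τ) • xf)
    (hx' : x' = x + (η * α) • (xg - x) - (η * β) • mulMat Bᵀ (mulMat B x - G)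
      - η • (s + e + r))
    (hxf' : xf' = xg + σ • (x' - x)) (hm : IsInexactModel h δ L μ xg s) :
    1 / η * ‖x' - xs‖ ^ 2 + 2 / σ * bregman h xf' xs ≤
      (1 / η - α) * ‖x - xs‖ ^ 2 - β * ‖mulMat B (x - xs)‖ ^ 2 + (2 / σ - 1) * bregman h xf xs
      - 1 / (4 * η) * ‖x' - x‖ ^ 2 + β * ‖G - mulMat B xs‖ ^ 2 - bregman h xg xs
      - 2 * ⟪r + ∇ h xs, x' - xs⟫ - 2 * ⟪e, x' - xs⟫ + (4 / σ + 1) * δ := by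
  have hc := hm.coupling hμ hσ hτ (xs := xs) hxg hxf'
  set D := x' - xs
  set N := ‖x' - x‖ ^ 2
  have hN : 0 ≤ N := sq_nonneg _
  have h1 : ‖D‖ ^ 2 = ‖x - xs‖ ^ 2 + 2 * ⟪x' - x, D⟫ - N := by
    have := two_mul_inner_sub_sub x' x x' xs
    rw [sub_self, norm_zero, norm_sub_rev x x'] at this
    simp only [D, N]
    linarith
  have h2 : ⟪x' - x, D⟫ = η * (α * ⟪xg - x, D⟫ - β * ⟪mulMat B x - G, mulMat B D⟫
      - (⟪s - ∇ h xs, D⟫ + ⟪e, D⟫ + ⟪r + ∇ h xs, D⟫)) := by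
    have e1 : x' - x = (η * α) • (xg - x) - (η * β) • mulMat Bᵀ (mulMat B x - G)
      - η • ((s - ∇ h xs) + e + (r + ∇ h xs)) := by
      rw [hx']; module
    have e2 : ⟪mulMat Bᵀ (mulMat B x - G), D⟫ = ⟪mulMat B x - G, mulMat B D⟫ := by
      rw [inner_mulMat, Matrix.transpose_transpose]
    rw [e1, inner_sub_left, inner_sub_left, real_inner_smul_left, real_inner_smul_left,
      real_inner_smul_left, inner_add_left, inner_add_left, e2]
    ring
  have h3 : 2 * ⟪xg - x, D⟫ ≤ ‖xg - xs‖ ^ 2 + N - ‖x - xs‖ ^ 2 := by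
    have := two_mul_inner_sub_sub xg x x' xs
    rw [norm_sub_rev x x'] at this
    have : 0 ≤ ‖xg - x'‖ ^ 2 := sq_nonneg _
    linarith
  have h4 : -(2 * ⟪mulMat B x - G, mulMat B D⟫) ≤
      -‖mulMat B (x - xs)‖ ^ 2 + K ^ 2 * N + ‖G - mulMat B xs‖ ^ 2 := by
    have := two_mul_inner_sub_sub (mulMat B x) G (mulMat B x') (mulMat B xs)
    rw [← map_sub, ← map_sub, ← map_sub, ← neg_sub x' x, map_neg, norm_neg] at this
    have hb : ‖mulMat B (x' - x)‖ ^ 2 ≤ K ^ 2 * N := by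
      rw [← mul_pow]
      exact pow_le_pow_left₀ (norm_nonneg _) (hB _) 2
    have : 0 ≤ ‖G - mulMat B x'‖ ^ 2 := sq_nonneg _
    linarith
  have h5 : 1 / η * ‖D‖ ^ 2 = 1 / η * ‖x - xs‖ ^ 2 + 2 * (α * ⟪xg - x, D⟫
      - β * ⟪mulMat B x - G, mulMat B D⟫
      - (⟪s - ∇ h xs, D⟫ + ⟪e, D⟫ + ⟪r + ∇ h xs, D⟫)) - 1 / η * N := by
    rw [h1, h2]
    field_simp
  have h3' := mul_le_mul_of_nonneg_left h3 hα
  have h4' := mul_le_mul_of_nonneg_left h4 hβ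
  have h6 : α * N + β * K ^ 2 * N + L * σ * N - 1 / η * N ≤ - (1 / (4 * η) * N) := by
    have : α + β * K ^ 2 + L * σ - 1 / η + 1 / (4 * η) ≤ 0 := by
      have : η * (α + β * K ^ 2 + L * σ - 1 / η + 1 / (4 * η)) ≤ 0 := by
        have e1 : η * (α + β * K ^ 2 + L * σ - 1 / η + 1 / (4 * η)) =
          η * (α + L * σ) + β * η * K ^ 2 - 3 / 4 := by field_simp; ring
        rw [e1]; linarith
      exact nonpos_of_mul_nonpos_right this hη
    have := mul_nonpos_of_nonpos_of_nonneg this hN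
    linarith
  have h7 : α * ‖xg - xs‖ ^ 2 ≤ μ * ‖xg - xs‖ ^ 2 := by gcongr
  linarith

end Block

section OneStep

variable {dx dy : ℕ} {c : Constants} {w : ℝ} {p : Params} {A : Matrix (Fin dy) (Fin dx) ℝ}
  {f : Vec dx → ℝ} {g : Vec dy → ℝ} {xs : Vec dx} {ys : Vec dy}

lemma Params.Contracting.ηx_mul_ηy (hc : c.Admissible) (hv : p.Valid c) (hp : p.Contracting c w) :
    16 * (p.ηx * p.ηy * c.Lxy ^ 2) ≤ 1 := by
  have hL := hc.Lxy_pos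
  have hw := hp.w_pos
  have h := mul_le_mul hp.ηx_coupling hp.ηy_coupling hv.ηy_pos.le (by positivity)
  have e : w / (4 * c.Lxy) * (1 / (4 * c.Lxy * w)) = 1 / (16 * c.Lxy ^ 2) := by
    field_simp; norm_num
  rw [e, le_div_iff₀ (by positivity)] at h
  linarith

/-- Young's inequality for the coupling term, with the weights of the Lyapunov function. -/
lemma Params.Contracting.abs_two_inner_le (hc : c.Admissible) (hv : p.Valid c)
    (hp : p.Contracting c w) (hA : ∀ v, ‖mulMat A v‖ ≤ c.Lxy * ‖v‖) (u : Vec dx) (d : Vec dy) :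
    |2 * ⟪mulMat A u, d⟫| ≤ 1 / (4 * p.ηy) * ‖d‖ ^ 2 + 1 / (4 * p.ηx) * ‖u‖ ^ 2 := by
  have h16 := hp.ηx_mul_ηy hc hv
  have hx := hv.ηx_pos
  have hy := hv.ηy_pos
  have h1 : |⟪mulMat A u, d⟫| ≤ c.Lxy * ‖u‖ * ‖d‖ :=
    (abs_real_inner_le_norm _ _).trans (by gcongr; exact hA u)
  rw [abs_mul, abs_two]
  refine (mul_le_mul_of_nonneg_left h1 zero_le_two).trans ?_
  have e : 1 / (4 * p.ηy) * ‖d‖ ^ 2 + 1 / (4 * p.ηx) * ‖u‖ ^ 2 - 2 * (c.Lxy * ‖u‖ * ‖d‖) =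
      1 / (4 * p.ηy) * ((‖d‖ - 4 * p.ηy * c.Lxy * ‖u‖) ^ 2)
      + 1 / (4 * p.ηx) * ‖u‖ ^ 2 * (1 - 16 * (p.ηx * p.ηy * c.Lxy ^ 2)) := by
    field_simp; ring
  have h2 : 0 ≤ 1 / (4 * p.ηx) * ‖u‖ ^ 2 * (1 - 16 * (p.ηx * p.ηy * c.Lxy ^ 2)) :=
    mul_nonneg (by positivity) (by linarith)
  have h3 : 0 ≤ 1 / (4 * p.ηy) * ((‖d‖ - 4 * p.ηy * c.Lxy * ‖u‖) ^ 2) := by positivity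
  linarith

/-- The Lyapunov function dominates both squared distances. -/
lemma Params.Contracting.le_lyapunov (hc : c.Admissible) (hv : p.Valid c)
    (hp : p.Contracting c w) (hf : MuStronglyConvex c.μx f) (hg : MuStronglyConvex c.μy g)
    (hA : ∀ v, ‖mulMat A v‖ ≤ c.Lxy * ‖v‖) (s : State dx dy) :
    3 * c.Lxy / w * ‖s.x - xs‖ ^ 2 + 4 * c.Lxy * w * ‖s.y - ys‖ ^ 2 ≤ lyapunov p A f g xs ys s := by
  have hL := hc.Lxy_pos
  have hw := hp.w_pos
  have hx := hv.ηx_pos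
  have hy := hv.ηy_pos
  have h1 := abs_le.1 (hp.abs_two_inner_le hc hv hA (s.x - xs) (s.y - s.yprev))
  have h2 : 3 * c.Lxy / w ≤ 1 / p.ηx - 1 / (4 * p.ηx) := by
    have h := hp.ηx_coupling
    rw [le_div_iff₀ (by positivity)] at h
    have : 1 / p.ηx - 1 / (4 * p.ηx) = 3 / (4 * p.ηx) := by field_simp; norm_num
    rw [this, div_le_div_iff₀ hw (by positivity)]
    linarith
  have h3 : 4 * c.Lxy * w ≤ 1 / p.ηy := by
    rw [le_div_iff₀ hy]
    have h := hp.ηy_coupling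
    rw [le_div_iff₀ (by positivity)] at h
    linarith
  have h4 := mul_le_mul_of_nonneg_right h2 (sq_nonneg ‖s.x - xs‖)
  have h5 := mul_le_mul_of_nonneg_right h3 (sq_nonneg ‖s.y - ys‖)
  have h6 : 0 ≤ 2 / p.σx * bregman f s.xf xs :=
    mul_nonneg (div_nonneg zero_le_two hv.σx_mem.1.le) (bregman_nonneg hc.μx_nonneg hf _ _)
  have h7 : 0 ≤ 2 / p.σy * bregman g s.yf ys :=
    mul_nonneg (div_nonneg zero_le_two hv.σy_mem.1.le) (bregman_nonneg hc.μy_nonneg hg _ _)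
  unfold lyapunov
  rw [real_inner_comm] at h1
  linarith [h1.2]

/-- The vector with which the noise of `f` is paired in `noiseTerm`. -/
noncomputable def noiseDualX (p : Params) (A : Matrix (Fin dy) (Fin dx) ℝ) (f : Vec dx → ℝ)
    (xs : Vec dx) (s : State dx dy) (sf : Vec dx) (sg : Vec dy) : Vec dx :=
  -(2 : ℝ) • ((step p A (fun _ => sf) (fun _ => sg) s).x - xs) + (2 * p.βy) • (sf - ∇ f xs)

/-- The vector with which the noise of `g` is paired in `noiseTerm`. -/
noncomputable def noiseDualY (p : Params) (A : Matrix (Fin dy) (Fin dx) ℝ) (g : Vec dy → ℝ)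
    (ys : Vec dy) (s : State dx dy) (sf : Vec dx) (sg : Vec dy) : Vec dy :=
  -(2 : ℝ) • ((step p A (fun _ => sf) (fun _ => sg) s).y - ys) + (2 * p.βx) • (sg - ∇ g ys)

/-- The noise of one iteration, linear and quadratic in the gradient noises `ef`, `eg`; the linear
terms are paired with vectors that the noise does not influence. -/
noncomputable def noiseTerm (p : Params) (A : Matrix (Fin dy) (Fin dx) ℝ) (f : Vec dx → ℝ)
    (g : Vec dy → ℝ) (xs : Vec dx) (ys : Vec dy) (s : State dx dy) (sf ef : Vec dx)
    (sg eg : Vec dy) : ℝ :=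
  ⟪ef, noiseDualX p A f xs s sf sg⟫ + ⟪eg, noiseDualY p A g ys s sf sg⟫
    + (-2 * p.ηx * p.βx + 2 * p.ηy * p.βy + 2 * p.ηy * p.ηx) * ⟪mulMat A ef, eg⟫
    + (2 * p.ηx + p.βy) * ‖ef‖ ^ 2 + (2 * p.ηy + p.βx) * ‖eg‖ ^ 2

/-- The new iterates are affine in the noise, with the noiseless step as constant part. Since `y` is
updated with the new `x`, the noise of `g` also reaches `y` through `x`; the resulting term in
`‖Aᵀ eg‖²` has a favourable sign and is dropped. -/
lemma noise_le_noiseTerm (hv : p.Valid c) (s : State dx dy) (sf ef : Vec dx) (sg eg : Vec dy) :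
    -2 * ⟪ef, (step p A (fun _ => sf + ef) (fun _ => sg + eg) s).x - xs⟫
      - 2 * ⟪eg, (step p A (fun _ => sf + ef) (fun _ => sg + eg) s).y - ys⟫
      + p.βx * (2 * ⟪eg, sg - ∇ g ys⟫ + ‖eg‖ ^ 2) + p.βy * (2 * ⟪ef, sf - ∇ f xs⟫ + ‖ef‖ ^ 2)
      ≤ noiseTerm p A f g xs ys s sf ef sg eg := by
  set t := step p A (fun _ => sf) (fun _ => sg) s with ht
  set t' := step p A (fun _ => sf + ef) (fun _ => sg + eg) s with ht'
  have ex : t'.x - xs = (t.x - xs) - p.ηx • ef + (p.ηx * p.βx) • mulMat Aᵀ eg := by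
    simp only [ht, ht', step, map_sub, map_add]
    module
  have exx : t'.x = t.x - p.ηx • ef + (p.ηx * p.βx) • mulMat Aᵀ eg := by
    simp only [ht, ht', step, map_sub, map_add]
    module
  have ey' : t'.y - t.y = - (p.ηy * p.βy) • mulMat A ef - p.ηy • eg
      + p.ηy • (mulMat A t'.x - mulMat A t.x) := by
    simp only [ht, ht', step, map_add]
    module
  have ey : t'.y - ys = (t.y - ys) - (p.ηy * p.βy + p.ηy * p.ηx) • mulMat A ef - p.ηy • eg
      + (p.ηy * (p.ηx * p.βx)) • mulMat A (mulMat Aᵀ eg) := by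
    rw [← sub_add_sub_cancel t'.y t.y ys, ey', exx]
    simp only [map_sub, map_add, map_smul]
    module
  have e1 : ⟪ef, mulMat Aᵀ eg⟫ = ⟪mulMat A ef, eg⟫ := (inner_mulMat A ef eg).symm
  have e2 : ⟪eg, mulMat A (mulMat Aᵀ eg)⟫ = ‖mulMat Aᵀ eg‖ ^ 2 := by
    rw [real_inner_comm, inner_mulMat, real_inner_self_eq_norm_sq]
  have e3 : ⟪eg, mulMat A ef⟫ = ⟪mulMat A ef, eg⟫ := real_inner_comm _ _
  have h : 0 ≤ p.ηy * (p.ηx * p.βx) * ‖mulMat Aᵀ eg‖ ^ 2 := by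
    have := hv.ηx_pos; have := hv.ηy_pos; have := hv.βx_pos
    positivity
  rw [ex, ey]
  unfold noiseTerm noiseDualX noiseDualY
  simp only [← ht, inner_add_right, inner_sub_right, real_inner_smul_right, e1, e2, e3,
    real_inner_self_eq_norm_sq] at *
  linarith

/-- Contraction of the Lyapunov function along one iteration, up to inexactness and noise. -/
lemma Params.Contracting.lyapunov_step_le (hc : c.Admissible) (hv : p.Valid c)
    (hp : p.Contracting c w) (hf : MuStronglyConvex c.μx f) (hg : MuStronglyConvex c.μy g)
    (hA : ∀ v, ‖mulMat A v‖ ≤ c.Lxy * ‖v‖) (hA' : ∀ v, ‖mulMat Aᵀ v‖ ≤ c.Lxy * ‖v‖)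
    (hfs : ∇ f xs = - mulMat Aᵀ ys) (hgs : ∇ g ys = mulMat A xs) {s : State dx dy}
    (hx : c.μyx ^ 2 * ‖s.x - xs‖ ^ 2 ≤ ‖mulMat A (s.x - xs)‖ ^ 2)
    (hy : c.μxy ^ 2 * ‖s.y - ys‖ ^ 2 ≤ ‖mulMat Aᵀ (s.y - ys)‖ ^ 2)
    {sf ef : Vec dx} {sg eg : Vec dy} {Dx Dy : ℝ}
    (hsf : IsInexactModel f Dx c.Lx c.μx (s.xg p) sf)
    (hsg : IsInexactModel g Dy c.Ly c.μy (s.yg p) sg) :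
    lyapunov p A f g xs ys (step p A (fun _ => sf + ef) (fun _ => sg + eg) s) ≤
      p.θ * lyapunov p A f g xs ys s + 4 / (1 - p.θ) * (Dx + Dy)
        + noiseTerm p A f g xs ys s sf ef sg eg := by
  have hnoise := noise_le_noiseTerm (f := f) (g := g) (A := A) (xs := xs) (ys := ys) hv s
    sf ef sg eg
  set t := step p A (fun _ => sf + ef) (fun _ => sg + eg) s with ht
  have hηx := hv.ηx_pos
  have hηy := hv.ηy_pos
  have hσx := hv.σx_mem.1
  have hσy := hv.σy_mem.1
  have hθ0 := hv.θ_mem.1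
  have hθ1 := hv.θ_mem.2
  -- the two blocks
  have bx := block_estimate (xs := xs) (e := ef) (r := mulMat Aᵀ (s.y + p.θ • (s.y - s.yprev)))
    (G := sg + eg) (x := s.x) (x' := t.x) (xf' := t.xf) (xf := s.xf) (xg := s.xg p) hc.μx_nonneg
    hv.ηx_pos
    hv.αx_nonneg hp.αx_le hv.βx_pos.le hv.σx_mem hp.τx_eq hp.ηx_smooth hp.βx_coupling hA rfl rfl rfl
    hsf
  have hby := block_estimate (xs := ys) (e := eg) (r := -mulMat A t.x) (G := -(sf + ef))
    (x := s.y) (x' := t.y) (xf' := t.yf) (xf := s.yf) (xg := s.yg p) hc.μy_nonneg hv.ηy_pos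
    hv.αy_nonneg hp.αy_le hv.βy_pos.le hv.σy_mem hp.τy_eq hp.ηy_smooth hp.βy_coupling hA' rfl
    (by rw [Matrix.transpose_transpose, sub_neg_eq_add, ← sub_eq_add_neg]; rfl) rfl hsg
  -- the bilinear terms of both blocks combine with the extrapolated `y`
  have cross : -2 * ⟪mulMat Aᵀ (s.y + p.θ • (s.y - s.yprev)) + ∇ f xs, t.x - xs⟫
      - 2 * ⟪-mulMat A t.x + ∇ g ys, t.y - ys⟫ =
      2 * ⟪t.y - s.y, mulMat A (t.x - xs)⟫ - p.θ * (2 * ⟪s.y - s.yprev, mulMat A (s.x - xs)⟫)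
        - p.θ * (2 * ⟪mulMat A (t.x - s.x), s.y - s.yprev⟫) := by
    have e1 : mulMat Aᵀ (s.y + p.θ • (s.y - s.yprev)) + ∇ f xs =
        mulMat Aᵀ ((s.y - ys) + p.θ • (s.y - s.yprev)) := by
      rw [hfs, ← sub_eq_add_neg, ← map_sub]
      congr 1; abel
    have e2 : -mulMat A t.x + ∇ g ys = - mulMat A (t.x - xs) := by rw [hgs, map_sub]; abel
    have e3 : t.x - s.x = (t.x - xs) - (s.x - xs) := by abel
    have e4 : t.y - ys = (t.y - s.y) + (s.y - ys) := by abel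
    rw [e1, e2, e3, e4, real_inner_comm, ← inner_mulMat]
    simp only [map_sub, inner_add_right, inner_neg_left, inner_neg_right, inner_sub_left,
      inner_sub_right, real_inner_smul_right, real_inner_comm s.y, real_inner_comm s.yprev, real_inner_comm t.y]
    ring
  have young : -(p.θ * (2 * ⟪mulMat A (t.x - s.x), s.y - s.yprev⟫)) ≤
      p.θ * (1 / (4 * p.ηy) * ‖s.y - s.yprev‖ ^ 2) + 1 / (4 * p.ηx) * ‖t.x - s.x‖ ^ 2 := by
    have h1 := (abs_le.1 (hp.abs_two_inner_le hc hv hA (t.x - s.x) (s.y - s.yprev))).1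
    have h2 := mul_le_mul_of_nonneg_left h1 hθ0.le
    have h3 : p.θ * (1 / (4 * p.ηx) * ‖t.x - s.x‖ ^ 2) ≤ 1 / (4 * p.ηx) * ‖t.x - s.x‖ ^ 2 :=
      mul_le_of_le_one_left (by positivity) hθ1.le
    linarith
  -- the gradient of the other function
  have hDx := hsf.nonneg
  have hDy := hsg.nonneg
  have hBf := bregman_nonneg hc.μx_nonneg hf
  have hBg := bregman_nonneg hc.μy_nonneg hg
  have gx : p.βx * ‖sg + eg - mulMat A xs‖ ^ 2 ≤ bregman g (s.yg p) ys + Dy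
      + p.βx * (2 * ⟪eg, sg - ∇ g ys⟫ + ‖eg‖ ^ 2) := by
    have h1 := hsg.norm_sub_gradient_sq_le hc.Ly_pos hc.μy_nonneg hg ys
    have h2 := mul_le_mul_of_nonneg_left h1 hv.βx_pos.le
    have h3 : p.βx * (2 * c.Ly) * (bregman g (s.yg p) ys + Dy) ≤ bregman g (s.yg p) ys + Dy :=
      mul_le_of_le_one_left (add_nonneg (hBg _ _) hDy) hp.βx_smooth
    have e1 : sg + eg - mulMat A xs = eg + (sg - ∇ g ys) := by rw [hgs]; abel
    rw [e1, norm_add_sq_real]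
    linarith
  have gy : p.βy * ‖-(sf + ef) - mulMat Aᵀ ys‖ ^ 2 ≤ bregman f (s.xg p) xs + Dx
      + p.βy * (2 * ⟪ef, sf - ∇ f xs⟫ + ‖ef‖ ^ 2) := by
    have h1 := hsf.norm_sub_gradient_sq_le hc.Lx_pos hc.μx_nonneg hf xs
    have h2 := mul_le_mul_of_nonneg_left h1 hv.βy_pos.le
    have h3 : p.βy * (2 * c.Lx) * (bregman f (s.xg p) xs + Dx) ≤ bregman f (s.xg p) xs + Dx :=
      mul_le_of_le_one_left (add_nonneg (hBf _ _) hDx) hp.βy_smooth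
    have e1 : -(sf + ef) - mulMat Aᵀ ys = -(ef + (sf - ∇ f xs)) := by rw [hfs]; abel
    rw [e1, norm_neg, norm_add_sq_real]
    linarith
  -- contraction of the individual terms
  have contr : ∀ {η α β μ a b : ℝ}, 0 < η → 0 ≤ a → 0 ≤ β → 1 - p.θ ≤ η * (α + β * μ ^ 2) →
      μ ^ 2 * a ≤ b → (1 / η - α) * a - β * b ≤ p.θ * (1 / η * a) := by
    intro η α β μ a b hη ha hβ h hab
    have h1 := mul_le_mul_of_nonneg_left hab hβ
    have h2 : 1 / η - α - β * μ ^ 2 ≤ p.θ * (1 / η) := by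
      have : 1 / η * (1 - p.θ) ≤ 1 / η * (η * (α + β * μ ^ 2)) := by gcongr
      rw [← mul_assoc, one_div_mul_cancel hη.ne'] at this
      linarith
    have h3 := mul_le_mul_of_nonneg_right h2 ha
    linarith
  have cx := contr hηx (sq_nonneg ‖s.x - xs‖) hv.βx_pos.le hp.θ_x hx
  have cy := contr hηy (sq_nonneg ‖s.y - ys‖) hv.βy_pos.le hp.θ_y hy
  have contrB : ∀ {σ B : ℝ}, 0 < σ → 0 ≤ B → 1 - p.θ ≤ σ / 2 →
      (2 / σ - 1) * B ≤ p.θ * (2 / σ * B) := by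
    intro σ B hσ hB h
    have h1 : 2 / σ * (1 - p.θ) ≤ 1 := by
      have : 2 / σ * (1 - p.θ) ≤ 2 / σ * (σ / 2) := by gcongr
      rwa [div_mul_div_cancel₀ hσ.ne', div_self two_ne_zero] at this
    have h2 := mul_le_mul_of_nonneg_right h1 hB
    linarith
  have cBx := contrB hσx (hBf s.xf xs) hp.θ_σx
  have cBy := contrB hσy (hBg s.yf ys) hp.θ_σy
  have contrD : ∀ {σ D : ℝ}, σ ∈ Set.Ioc (0 : ℝ) 1 → 0 ≤ D → 1 - p.θ ≤ σ / 2 →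
      (4 / σ + 1) * D + D ≤ 4 / (1 - p.θ) * D := by
    intro σ D hσ hD h
    have h1 : 2 / σ ≤ 1 / (1 - p.θ) := by
      rw [div_le_div_iff₀ hσ.1 (by linarith)]; linarith
    have h2 : 1 ≤ 1 / σ := by rw [le_div_iff₀ hσ.1, one_mul]; exact hσ.2
    have h3 : 4 / σ + 1 + 1 ≤ 4 / (1 - p.θ) := by
      have e1 : 4 / σ = 4 * (1 / σ) := by ring
      have e2 : 2 / σ = 2 * (1 / σ) := by ring
      have e3 : 4 / (1 - p.θ) = 4 * (1 / (1 - p.θ)) := by ring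
      rw [e2] at h1
      rw [e1, e3]
      linarith
    have h4 := mul_le_mul_of_nonneg_right h3 hD
    linarith
  have dX := contrD hv.σx_mem hDx hp.θ_σx
  have dY := contrD hv.σy_mem hDy hp.θ_σy
  have hyp : t.yprev = s.y := rfl
  unfold lyapunov
  rw [hyp]
  linarith

end OneStep

/-! ### Fresh samples are independent of the past -/

lemma integrable_inner_of_memLp {Ω : Type*} [MeasurableSpace Ω] {P : Measure Ω} {d : ℕ}
    {u v : Ω → Vec d} (hu : MemLp u 2 P) (hv : MemLp v 2 P) :
    Integrable (fun ω => ⟪u ω, v ω⟫) P :=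
  (hu.norm.integrable_mul hv.norm).mono (hu.1.inner hv.1)
    (Filter.Eventually.of_forall fun ω => by
      simpa using abs_real_inner_le_norm (u ω) (v ω))

section Independence

variable {Ω : Type*} {𝓦 : Type*} {Ξ : Type*} [MeasurableSpace Ω] [MeasurableSpace 𝓦]
  [MeasurableSpace Ξ] {P : Measure Ω} [IsProbabilityMeasure P] {W : Ω → 𝓦} {ζ : Ω → Ξ}

/-- A sample independent of `W` may be replaced by an independent copy on a second factor. Keeping
the first factor `Ω` (instead of the law of `W`) allows hypotheses that hold almost surely on `Ω`,
whose exceptional sets need not be preimages of measurable sets. -/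
lemma map_pair_eq_map_prod (hW : Measurable W) (hζ : Measurable ζ) (h : IndepFun W ζ P) :
    P.map (fun ω => (W ω, ζ ω)) = (P.prod (P.map ζ)).map (Prod.map W id) := by
  rw [(indepFun_iff_map_prod_eq_prod_map_map hW.aemeasurable hζ.aemeasurable).1 h,
    ← Measure.map_prod_map _ _ hW measurable_id, Measure.map_id]

lemma integrable_pair_iff {E : Type*} [NormedAddCommGroup E] (hW : Measurable W)
    (hζ : Measurable ζ) (h : IndepFun W ζ P) {φ : 𝓦 × Ξ → E} (hφ : StronglyMeasurable φ) :
    Integrable (fun ω => φ (W ω, ζ ω)) P ↔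
      Integrable (fun q : Ω × Ξ => φ (W q.1, q.2)) (P.prod (P.map ζ)) := by
  have h1 := integrable_map_measure (μ := P) hφ.aestronglyMeasurable (hW.prodMk hζ).aemeasurable
  rw [map_pair_eq_map_prod hW hζ h, integrable_map_measure hφ.aestronglyMeasurable
    (hW.prodMap measurable_id).aemeasurable] at h1
  exact h1.symm

lemma integral_pair_eq (hW : Measurable W) (hζ : Measurable ζ) (h : IndepFun W ζ P)
    {φ : 𝓦 × Ξ → ℝ} (hφ : StronglyMeasurable φ) (hint : Integrable (fun ω => φ (W ω, ζ ω)) P) :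
    ∫ ω, φ (W ω, ζ ω) ∂P = ∫ ω, ∫ z, φ (W ω, z) ∂(P.map ζ) ∂P := by
  have h1 := integral_map (μ := P) (hW.prodMk hζ).aemeasurable hφ.aestronglyMeasurable
  have := Measure.isProbabilityMeasure_map (μ := P) hζ.aemeasurable
  rw [← h1, map_pair_eq_map_prod hW hζ h, integral_map (hW.prodMap measurable_id).aemeasurable
    hφ.aestronglyMeasurable]
  exact integral_prod _ ((integrable_pair_iff hW hζ h hφ).1 hint)

variable {d : ℕ}

/-- A vector whose mean over the fresh sample vanishes is uncorrelated with the past. -/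
lemma integral_inner_eq_zero_of_indepFun (hW : Measurable W) (hζ : Measurable ζ)
    (h : IndepFun W ζ P) {K : 𝓦 → Ξ → Vec d} (hK : Measurable (Function.uncurry K))
    {U : 𝓦 → Vec d} (hU : Measurable U) (hKi : MemLp (fun ω => K (W ω) (ζ ω)) 2 P)
    (hUi : MemLp (fun ω => U (W ω)) 2 P) (h0 : ∀ᵐ ω ∂P, ∫ z, K (W ω) z ∂(P.map ζ) = 0) :
    ∫ ω, ⟪K (W ω) (ζ ω), U (W ω)⟫ ∂P = 0 := by
  have := Measure.isProbabilityMeasure_map (μ := P) hζ.aemeasurable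
  have hφ : StronglyMeasurable fun q : 𝓦 × Ξ => ⟪K q.1 q.2, U q.1⟫ :=
    (hK.inner (hU.comp measurable_fst)).stronglyMeasurable
  have hint : Integrable (fun ω => ⟪K (W ω) (ζ ω), U (W ω)⟫) P := integrable_inner_of_memLp hKi hUi
  rw [integral_pair_eq hW hζ h hφ hint]
  have hsec := ((integrable_pair_iff hW hζ h hK.stronglyMeasurable).1
    (hKi.integrable one_le_two)).prod_right_ae
  refine integral_eq_zero_of_ae ?_
  filter_upwards [h0, hsec] with ω h1 h2
  have h2' : Integrable (K (W ω)) (P.map ζ) := h2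
  simp only [real_inner_comm (U (W ω))]
  rw [integral_inner h2', h1, inner_zero_right]
  rfl

/-- A uniform bound on the conditional second moments bounds the second moment. -/
lemma memLp_two_of_conditional (hW : Measurable W) (hζ : Measurable ζ)
    (h : IndepFun W ζ P) {K : 𝓦 → Ξ → Vec d} (hK : Measurable (Function.uncurry K)) {V : ℝ}
    (hV : ∀ᵐ ω ∂P, MemLp (K (W ω)) 2 (P.map ζ) ∧ ∫ z, ‖K (W ω) z‖ ^ 2 ∂(P.map ζ) ≤ V) :
    MemLp (fun ω => K (W ω) (ζ ω)) 2 P ∧ ∫ ω, ‖K (W ω) (ζ ω)‖ ^ 2 ∂P ≤ V := by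
  have := Measure.isProbabilityMeasure_map (μ := P) hζ.aemeasurable
  have hφ : StronglyMeasurable fun q : 𝓦 × Ξ => ‖K q.1 q.2‖ ^ 2 :=
    (hK.norm.pow_const 2).stronglyMeasurable
  have hpair : Measurable fun q : Ω × Ξ => (W q.1, q.2) :=
    (hW.comp measurable_fst).prodMk measurable_snd
  have hφW := hφ.comp_measurable hpair
  have hi : Integrable (fun ω => ‖K (W ω) (ζ ω)‖ ^ 2) P := by
    refine (integrable_pair_iff hW hζ h hφ).2 ?_
    refine (integrable_prod_iff hφW.aestronglyMeasurable).2 ⟨?_, ?_⟩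
    · filter_upwards [hV] with ω hω
      exact hω.1.integrable_norm_pow two_ne_zero
    · refine Integrable.of_bound (C := V) hφW.norm.integral_prod_right'.aestronglyMeasurable ?_
      filter_upwards [hV] with ω hω
      rw [Real.norm_of_nonneg (integral_nonneg fun _ => norm_nonneg _)]
      simpa using hω.2
  refine ⟨(memLp_two_iff_integrable_sq_norm
    (hK.comp (hW.prodMk hζ)).aestronglyMeasurable).2 hi, ?_⟩
  rw [integral_pair_eq hW hζ h hφ hi]
  refine (integral_mono_of_nonneg (Filter.Eventually.of_forall fun ω => integral_nonneg
    fun _ => sq_nonneg _) (integrable_const V) ?_).trans (by simp)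
  filter_upwards [hV] with ω hω using hω.2

end Independence

section Samples

variable {rf rg : ℕ} {Ω : Type u} {Ξ : Type v} [MeasurableSpace Ω] [MeasurableSpace Ξ]
  {P : Measure Ω} {ξx : ℕ → Fin rf → Ω → Ξ} {ξy : ℕ → Fin rg → Ω → Ξ}

/-- All samples, as a family indexed by the iteration and the position in the batch. -/
abbrev allSamples (ξx : ℕ → Fin rf → Ω → Ξ) (ξy : ℕ → Fin rg → Ω → Ξ) :
    ℕ × Fin rf ⊕ ℕ × Fin rg → Ω → Ξ :=
  Sum.elim (fun q => ξx q.1 q.2) (fun q => ξy q.1 q.2)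

/-- The iteration at which a sample is drawn. -/
def sampleTime : ℕ × Fin rf ⊕ ℕ × Fin rg → ℕ := Sum.elim Prod.fst Prod.fst

lemma SamplingAssumption.measurable_allSamples (h : SamplingAssumption P ξx ξy)
    (a : ℕ × Fin rf ⊕ ℕ × Fin rg) : Measurable (allSamples ξx ξy a) := by
  rcases a with a | a
  · exact h.measurable_x _ _
  · exact h.measurable_y _ _

lemma SamplingAssumption.measurable_history (h : SamplingAssumption P ξx ξy) (k : ℕ) :
    Measurable (history ξx ξy k) :=
  (measurable_pi_iff.2 fun _ => measurable_pi_iff.2 fun _ => h.measurable_x _ _).prodMk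
    (measurable_pi_iff.2 fun _ => measurable_pi_iff.2 fun _ => h.measurable_y _ _)

/-- A sample is independent of a finite family of other samples, hence of any measurable function
of such a family. -/
lemma SamplingAssumption.indepFun_history_prod (h : SamplingAssumption P ξx ξy) {k : ℕ}
    {a b : ℕ × Fin rf ⊕ ℕ × Fin rg} (ha : k ≤ sampleTime a) (hab : b ≠ a) :
    IndepFun (fun ω => (history ξx ξy k ω, allSamples ξx ξy b ω)) (allSamples ξx ξy a) P := by
  classical
  let S : Finset (ℕ × Fin rf ⊕ ℕ × Fin rg) :=
    insert b ((Finset.range k ×ˢ Finset.univ).disjSum (Finset.range k ×ˢ Finset.univ))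
  have hl : ∀ (l : Fin k) i, Sum.inl (l.1, i) ∈ S := fun l i => by simp [S]
  have hr : ∀ (l : Fin k) i, Sum.inr (l.1, i) ∈ S := fun l i => by simp [S]
  have hb : b ∈ S := by simp [S]
  have haS : a ∉ S := by
    rcases a with a | a <;> simp [S, hab.symm, sampleTime] at ha ⊢ <;> omega
  have h1 := h.indep.indepFun_finset S {a} (by simpa using haS) h.measurable_allSamples
  have hψ : Measurable fun v : S → Ξ => (((fun l i => v ⟨_, hl l i⟩, fun l i => v ⟨_, hr l i⟩) :
      History rf rg Ξ k), v ⟨b, hb⟩) :=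
    ((measurable_pi_iff.2 fun _ => measurable_pi_iff.2 fun _ => measurable_pi_apply _).prodMk
      (measurable_pi_iff.2 fun _ => measurable_pi_iff.2 fun _ => measurable_pi_apply _)).prodMk
      (measurable_pi_apply _)
  exact h1.comp hψ (measurable_pi_apply (⟨a, by simp⟩ : ({a} : Finset _)))

lemma SamplingAssumption.indepFun_history (h : SamplingAssumption P ξx ξy) {k : ℕ}
    {a : ℕ × Fin rf ⊕ ℕ × Fin rg} (ha : k ≤ sampleTime a) :
    IndepFun (history ξx ξy k) (allSamples ξx ξy a) P := by
  -- a later sample serves as the auxiliary one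
  obtain ⟨b, hb⟩ : ∃ b : ℕ × Fin rf ⊕ ℕ × Fin rg, b ≠ a := by
    rcases a with a | a
    · exact ⟨Sum.inl (a.1 + 1, a.2), fun h => by simpa [sampleTime] using congrArg sampleTime h⟩
    · exact ⟨Sum.inr (a.1 + 1, a.2), fun h => by simpa [sampleTime] using congrArg sampleTime h⟩
  exact (h.indepFun_history_prod ha hb).comp measurable_fst measurable_id

end Samples

/-! ### Batches of stochastic gradients -/

section Batch

variable {Ω : Type*} [MeasurableSpace Ω] {P : Measure Ω} {d m r : ℕ}

lemma batchMean_add (v w : Fin r → Vec d) :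
    batchMean (fun i => v i + w i) = batchMean v + batchMean w := by
  simp only [batchMean, Finset.sum_add_distrib, smul_add]

lemma memLp_batchMean {v : Fin r → Ω → Vec d} (hv : ∀ i, MemLp (v i) 2 P) :
    MemLp (fun ω => batchMean fun i => v i ω) 2 P := by
  have := (memLp_finsetSum Finset.univ fun i _ => hv i).const_smul (r : ℝ)⁻¹
  exact this

lemma measurable_batchMean {𝓦 : Type*} [MeasurableSpace 𝓦] {v : Fin r → 𝓦 → Vec d}
    (hv : ∀ i, Measurable (v i)) : Measurable fun h => batchMean fun i => v i h := by
  unfold batchMean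
  fun_prop

lemma integral_inner_batchMean_eq_zero {v : Fin r → Ω → Vec d} {U : Ω → Vec d}
    (hv : ∀ i, MemLp (v i) 2 P) (hU : MemLp U 2 P) (h0 : ∀ i, ∫ ω, ⟪v i ω, U ω⟫ ∂P = 0) :
    ∫ ω, ⟪batchMean fun i => v i ω, U ω⟫ ∂P = 0 := by
  simp only [batchMean, real_inner_smul_left, sum_inner]
  rw [integral_const_mul, integral_finsetSum _ fun i _ => integrable_inner_of_memLp (hv i) hU]
  simp [h0]

/-- Averaging uncorrelated vectors divides the second moment by the batch size. -/
lemma integral_norm_batchMean_sq_le {v : Fin r → Ω → Vec d} {V : ℝ} (hv : ∀ i, MemLp (v i) 2 P)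
    (horth : ∀ i j, i ≠ j → ∫ ω, ⟪v i ω, v j ω⟫ ∂P = 0) (hV : ∀ i, ∫ ω, ‖v i ω‖ ^ 2 ∂P ≤ V) :
    ∫ ω, ‖batchMean fun i => v i ω‖ ^ 2 ∂P ≤ V / r := by
  have e : ∀ ω, ‖batchMean fun i => v i ω‖ ^ 2 =
      (r : ℝ)⁻¹ * ((r : ℝ)⁻¹ * ∑ i, ∑ j, ⟪v i ω, v j ω⟫) := by
    intro ω
    simp only [← real_inner_self_eq_norm_sq, batchMean, real_inner_smul_left,
      real_inner_smul_right, sum_inner, inner_sum, Finset.mul_sum]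
    exact Finset.sum_comm
  have hi : ∀ i j, Integrable (fun ω => ⟪v i ω, v j ω⟫) P :=
    fun i j => integrable_inner_of_memLp (hv i) (hv j)
  simp only [e]
  rw [integral_const_mul, integral_const_mul,
    integral_finsetSum _ fun i _ => integrable_finsetSum _ fun j _ => hi i j]
  have h1 : ∀ i, ∫ ω, ∑ j, ⟪v i ω, v j ω⟫ ∂P ≤ V := by
    intro i
    rw [integral_finsetSum _ fun j _ => hi i j,
      Finset.sum_eq_single i (fun j _ hj => horth i j hj.symm) (by simp)]
    simpa using hV i
  have h2 := Finset.sum_le_card_nsmul Finset.univ _ _ fun i _ => h1 i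
  rw [Finset.card_univ, Fintype.card_fin, nsmul_eq_mul] at h2
  rcases Nat.eq_zero_or_pos r with rfl | hr
  · simp
  have hr' : (0 : ℝ) < r := by exact_mod_cast hr
  calc (r : ℝ)⁻¹ * ((r : ℝ)⁻¹ * ∑ i, ∫ ω, ∑ j, ⟪v i ω, v j ω⟫ ∂P)
      ≤ (r : ℝ)⁻¹ * ((r : ℝ)⁻¹ * (r * V)) := by gcongr
    _ = V / r := by field_simp

end Batch

/-! ### Conditional means and noises of an oracle -/

section Conditional

variable {Ω : Type*} {𝓗 : Type*} {𝓦 : Type*} {Ξ : Type*} [MeasurableSpace Ω] [MeasurableSpace 𝓗]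
  [MeasurableSpace 𝓦] [MeasurableSpace Ξ] {d : ℕ}

/-- The mean of `F h` over the sample `ζ`, as a function of the past `h`. -/
noncomputable def condMean (P : Measure Ω) (ζ : Ω → Ξ) (F : 𝓗 → Ξ → Vec d) (h : 𝓗) : Vec d :=
  ∫ z, F h z ∂(P.map ζ)

/-- The deviation of `F h` from its mean over the sample `ζ`. -/
noncomputable def condNoise (P : Measure Ω) (ζ : Ω → Ξ) (F : 𝓗 → Ξ → Vec d) (h : 𝓗) (z : Ξ) :
    Vec d :=
  F h z - condMean P ζ F h

variable {P : Measure Ω} [IsProbabilityMeasure P] {H : Ω → 𝓗} {ζ : Ω → Ξ} {F : 𝓗 → Ξ → Vec d}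
  {h : Vec d → ℝ} {L μ σ : ℝ} {Δ : 𝓗 → ℝ} {X : Ω → Vec d}

lemma measurable_condMean (hF : Measurable (Function.uncurry F)) :
    Measurable (condMean P ζ F) :=
  (StronglyMeasurable.integral_prod_right' hF.stronglyMeasurable).measurable

lemma measurable_condNoise (hF : Measurable (Function.uncurry F)) :
    Measurable (Function.uncurry (condNoise P ζ F)) :=
  hF.sub ((measurable_condMean hF).comp measurable_fst)

lemma memLp_condNoise (hH : Measurable H) (hζ : Measurable ζ) (hind : IndepFun H ζ P)
    (hF : Measurable (Function.uncurry F))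
    (hm : ∀ᵐ ω ∂P, IsStochasticModel h (Δ (H ω)) L μ σ (P.map ζ) (F (H ω)) (X ω)) :
    MemLp (fun ω => condNoise P ζ F (H ω) (ζ ω)) 2 P ∧
      ∫ ω, ‖condNoise P ζ F (H ω) (ζ ω)‖ ^ 2 ∂P ≤ σ ^ 2 := by
  have := Measure.isProbabilityMeasure_map (μ := P) hζ.aemeasurable
  refine memLp_two_of_conditional hH hζ hind (measurable_condNoise hF) ?_
  filter_upwards [hm] with ω hω
  exact ⟨hω.1.sub (memLp_const _), hω.2.2⟩

/-- The noise of a sample is uncorrelated with every variable `U` of which, together with the past,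
the sample is independent. -/
lemma integral_inner_condNoise_eq_zero {W : Ω → 𝓦} {π : 𝓦 → 𝓗} (hW : Measurable W)
    (hπ : Measurable π) (hπW : ∀ ω, π (W ω) = H ω) (hζ : Measurable ζ) (hind : IndepFun W ζ P)
    (hF : Measurable (Function.uncurry F))
    (hm : ∀ᵐ ω ∂P, IsStochasticModel h (Δ (H ω)) L μ σ (P.map ζ) (F (H ω)) (X ω))
    {U : 𝓦 → Vec d} (hU : Measurable U) (hUi : MemLp (fun ω => U (W ω)) 2 P) :
    ∫ ω, ⟪condNoise P ζ F (H ω) (ζ ω), U (W ω)⟫ ∂P = 0 := by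
  have := Measure.isProbabilityMeasure_map (μ := P) hζ.aemeasurable
  have eH : π ∘ W = H := funext hπW
  have hindH : IndepFun H ζ P := eH ▸ hind.comp hπ measurable_id
  have hH : Measurable H := eH ▸ hπ.comp hW
  have hmeas : Measurable (Function.uncurry fun w z => condNoise P ζ F (π w) z) :=
    (measurable_condNoise hF).comp ((hπ.comp measurable_fst).prodMk measurable_snd)
  have key := integral_inner_eq_zero_of_indepFun (P := P) hW hζ hind hmeas hU
    (by simpa only [hπW] using (memLp_condNoise hH hζ hindH hF hm).1) hUi ?_
  · simpa only [hπW] using key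
  · filter_upwards [hm] with ω hω
    simp only [hπW, condNoise]
    rw [integral_sub (hω.1.integrable one_le_two) (integrable_const _)]
    simp [condMean]

/-- Square integrability of the mean gradient, by inexact co-coercivity at a reference point. -/
lemma memLp_condMean (hL : 0 < L) (hμ : 0 ≤ μ) (hc : MuStronglyConvex μ h) (hs : LSmooth L h)
    (hH : Measurable H) (hF : Measurable (Function.uncurry F)) (hX : MemLp X 2 P)
    (hΔ : Integrable (fun ω => Δ (H ω)) P)
    (hm : ∀ᵐ ω ∂P, IsStochasticModel h (Δ (H ω)) L μ σ (P.map ζ) (F (H ω)) (X ω)) :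
    MemLp (fun ω => condMean P ζ F (H ω)) 2 P := by
  have hmeas : AEStronglyMeasurable (fun ω => condMean P ζ F (H ω) - ∇ h 0) P :=
    (((measurable_condMean hF).comp hH).sub measurable_const).aestronglyMeasurable
  have h1 : MemLp (fun ω => condMean P ζ F (H ω) - ∇ h 0) 2 P := by
    refine (memLp_two_iff_integrable_sq_norm hmeas).2 ?_
    have hdom : Integrable (fun ω => 2 * L * (L / 2 * ‖X ω‖ ^ 2 + Δ (H ω))) P :=
      (((hX.integrable_norm_pow two_ne_zero).const_mul (L / 2)).add hΔ).const_mul (2 * L)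
    refine hdom.mono' (hmeas.norm.pow 2) ?_
    filter_upwards [hm] with ω hω
    rw [Real.norm_of_nonneg (sq_nonneg _)]
    refine (hω.2.1.norm_sub_gradient_sq_le hL hμ hc 0).trans ?_
    have := bregman_le hs (X ω) 0
    rw [sub_zero] at this
    gcongr
  have h2 := h1.add (memLp_const (∇ h 0))
  refine h2.ae_eq (Filter.Eventually.of_forall fun ω => ?_)
  simp

end Conditional

/-! ### The iterates as functions of the past samples -/

section Iterates

variable {dx dy rf rg : ℕ}

/-- The samples of all but the last iteration. -/
def History.dropLast {Ξ : Type v} {k : ℕ} (h : History rf rg Ξ (k + 1)) : History rf rg Ξ k :=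
  (fun l => h.1 l.castSucc, fun l => h.2 l.castSucc)

/-- The state before iteration `k`, computed from the past samples. -/
noncomputable def stateOf {Ξ : Type v} (p : Params) (A : Matrix (Fin dy) (Fin dx) ℝ)
    (Gf : Oracle rf rg Ξ dx) (Gg : Oracle rf rg Ξ dy) (x₀ : Vec dx) (y₀ : Vec dy) :
    (k : ℕ) → History rf rg Ξ k → State dx dy
  | 0, _ => State.init x₀ y₀
  | k + 1, h =>
      let s := stateOf p A Gf Gg x₀ y₀ k h.dropLast
      step p A (fun _ => batchMean fun i => Gf k h.dropLast (s.xg p) (h.1 (Fin.last k) i))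
        (fun _ => batchMean fun j => Gg k h.dropLast (s.yg p) (h.2 (Fin.last k) j)) s

lemma iterate_eq_stateOf {Ω : Type u} {Ξ : Type v} (p : Params)
    (A : Matrix (Fin dy) (Fin dx) ℝ) (Gf : Oracle rf rg Ξ dx) (Gg : Oracle rf rg Ξ dy)
    (ξx : ℕ → Fin rf → Ω → Ξ) (ξy : ℕ → Fin rg → Ω → Ξ) (x₀ : Vec dx) (y₀ : Vec dy)
    (k : ℕ) (ω : Ω) :
    iterate p A Gf Gg ξx ξy x₀ y₀ k ω = stateOf p A Gf Gg x₀ y₀ k (history ξx ξy k ω) := by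
  induction k with
  | zero => rfl
  | succ k ih =>
    have e : (history ξx ξy (k + 1) ω).dropLast = history ξx ξy k ω := rfl
    simp only [iterate, stateOf]
    rw [e, ← ih]
    rfl

/-- All components of a random state are measurable. -/
structure State.IsMeasurable {𝓗 : Type*} [MeasurableSpace 𝓗] (S : 𝓗 → State dx dy) : Prop where
  x : Measurable fun h => (S h).x
  xf : Measurable fun h => (S h).xf
  y : Measurable fun h => (S h).y
  yf : Measurable fun h => (S h).yf
  yprev : Measurable fun h => (S h).yprev

/-- All components of a random state are square integrable. -/
structure State.IsSquareIntegrable {Ω : Type*} [MeasurableSpace Ω] (P : Measure Ω)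
    (S : Ω → State dx dy) : Prop where
  x : MemLp (fun ω => (S ω).x) 2 P
  xf : MemLp (fun ω => (S ω).xf) 2 P
  y : MemLp (fun ω => (S ω).y) 2 P
  yf : MemLp (fun ω => (S ω).yf) 2 P
  yprev : MemLp (fun ω => (S ω).yprev) 2 P

lemma measurable_mulMat {m n : ℕ} (A : Matrix (Fin m) (Fin n) ℝ) :
    Measurable fun v : Vec n => mulMat A v :=
  (mulMat A).continuous_of_finiteDimensional.measurable

lemma memLp_mulMat {Ω : Type*} [MeasurableSpace Ω] {P : Measure Ω} {m n : ℕ}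
    (A : Matrix (Fin m) (Fin n) ℝ) {v : Ω → Vec n} (hv : MemLp v 2 P) :
    MemLp (fun ω => mulMat A (v ω)) 2 P :=
  (mulMat A).toContinuousLinearMap.comp_memLp' hv

lemma State.IsMeasurable.xg {𝓗 : Type*} [MeasurableSpace 𝓗] {S : 𝓗 → State dx dy}
    (hS : State.IsMeasurable S) (p : Params) : Measurable fun h => (S h).xg p :=
  (hS.x.const_smul p.τx).add (hS.xf.const_smul (1 - p.τx))

lemma State.IsMeasurable.yg {𝓗 : Type*} [MeasurableSpace 𝓗] {S : 𝓗 → State dx dy}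
    (hS : State.IsMeasurable S) (p : Params) : Measurable fun h => (S h).yg p :=
  (hS.y.const_smul p.τy).add (hS.yf.const_smul (1 - p.τy))

lemma State.IsMeasurable.step {𝓗 : Type*} [MeasurableSpace 𝓗] {S : 𝓗 → State dx dy}
    (hS : State.IsMeasurable S) (p : Params) (A : Matrix (Fin dy) (Fin dx) ℝ)
    {df : 𝓗 → Vec dx} {dg : 𝓗 → Vec dy} (hdf : Measurable df) (hdg : Measurable dg) :
    State.IsMeasurable fun h => step p A (fun _ => df h) (fun _ => dg h) (S h) := by
  have hxg := hS.xg p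
  have hyg := hS.yg p
  have hx := hS.x
  have hy := hS.y
  have hym := hy.add ((hy.sub hS.yprev).const_smul p.θ)
  have hx' := ((hx.add ((hxg.sub hx).const_smul (p.ηx * p.αx))).sub
    (((measurable_mulMat Aᵀ).comp (((measurable_mulMat A).comp hx).sub hdg)).const_smul
      (p.ηx * p.βx))).sub ((hdf.add ((measurable_mulMat Aᵀ).comp hym)).const_smul p.ηx)
  have hy' := ((hy.add ((hyg.sub hy).const_smul (p.ηy * p.αy))).sub
    (((measurable_mulMat A).comp (((measurable_mulMat Aᵀ).comp hy).add hdf)).const_smul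
      (p.ηy * p.βy))).sub ((hdg.sub ((measurable_mulMat A).comp hx')).const_smul p.ηy)
  exact ⟨hx', hxg.add ((hx'.sub hx).const_smul p.σx), hy',
    hyg.add ((hy'.sub hy).const_smul p.σy), hy⟩

section SquareIntegrable

variable {Ω : Type*} [MeasurableSpace Ω] {P : Measure Ω} {S : Ω → State dx dy}

lemma State.IsSquareIntegrable.xg (hS : State.IsSquareIntegrable P S) (p : Params) :
    MemLp (fun ω => (S ω).xg p) 2 P :=
  (hS.x.const_smul p.τx).add (hS.xf.const_smul (1 - p.τx))

lemma State.IsSquareIntegrable.yg (hS : State.IsSquareIntegrable P S) (p : Params) :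
    MemLp (fun ω => (S ω).yg p) 2 P :=
  (hS.y.const_smul p.τy).add (hS.yf.const_smul (1 - p.τy))

lemma State.IsSquareIntegrable.step (hS : State.IsSquareIntegrable P S) (p : Params)
    (A : Matrix (Fin dy) (Fin dx) ℝ) {df : Ω → Vec dx} {dg : Ω → Vec dy} (hdf : MemLp df 2 P)
    (hdg : MemLp dg 2 P) :
    State.IsSquareIntegrable P fun ω => step p A (fun _ => df ω) (fun _ => dg ω) (S ω) := by
  have hxg := hS.xg p
  have hyg := hS.yg p
  have hx := hS.x
  have hy := hS.y
  have hym := hy.add ((hy.sub hS.yprev).const_smul p.θ)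
  have hx' := ((hx.add ((hxg.sub hx).const_smul (p.ηx * p.αx))).sub
    ((memLp_mulMat Aᵀ ((memLp_mulMat A hx).sub hdg)).const_smul
      (p.ηx * p.βx))).sub ((hdf.add (memLp_mulMat Aᵀ hym)).const_smul p.ηx)
  have hy' := ((hy.add ((hyg.sub hy).const_smul (p.ηy * p.αy))).sub
    ((memLp_mulMat A ((memLp_mulMat Aᵀ hy).add hdf)).const_smul
      (p.ηy * p.βy))).sub ((hdg.sub (memLp_mulMat A hx')).const_smul p.ηy)
  exact ⟨hx', hxg.add ((hx'.sub hx).const_smul p.σx), hy',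
    hyg.add ((hy'.sub hy).const_smul p.σy), hy⟩

lemma integrable_bregman [IsFiniteMeasure P] {d : ℕ} {h : Vec d → ℝ} {L μ : ℝ} (hμ : 0 ≤ μ)
    (hc : MuStronglyConvex μ h) (hs : LSmooth L h) {X : Ω → Vec d} (hX : MemLp X 2 P)
    (z : Vec d) : Integrable (fun ω => bregman h (X ω) z) P := by
  refine (((hX.sub (memLp_const z)).integrable_norm_pow two_ne_zero).const_mul (L / 2)).mono'
    ((continuous_bregman hs z).comp_aestronglyMeasurable hX.1) ?_
  refine Filter.Eventually.of_forall fun ω => ?_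
  rw [Real.norm_of_nonneg (bregman_nonneg hμ hc _ _)]
  exact bregman_le hs _ _

lemma State.IsSquareIntegrable.integrable_lyapunov [IsFiniteMeasure P]
    (hS : State.IsSquareIntegrable P S) {c : Constants} (hc : c.Admissible) (p : Params)
    (A : Matrix (Fin dy) (Fin dx) ℝ) {f : Vec dx → ℝ} {g : Vec dy → ℝ}
    (hf : MuStronglyConvex c.μx f) (hfs : LSmooth c.Lx f) (hg : MuStronglyConvex c.μy g)
    (hgs : LSmooth c.Ly g) (xs : Vec dx) (ys : Vec dy) :
    Integrable (fun ω => lyapunov p A f g xs ys (S ω)) P := by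
  have hx := hS.x.sub (memLp_const xs)
  have hy := hS.y.sub (memLp_const ys)
  have hyy := hS.y.sub hS.yprev
  exact ((((((hx.integrable_norm_pow two_ne_zero).const_mul _).add
    ((hy.integrable_norm_pow two_ne_zero).const_mul _)).add
    ((integrable_bregman hc.μx_nonneg hf hfs hS.xf xs).const_mul _)).add
    ((integrable_bregman hc.μy_nonneg hg hgs hS.yf ys).const_mul _)).add
    ((hyy.integrable_norm_pow two_ne_zero).const_mul _)).sub
    ((integrable_inner_of_memLp hyy (memLp_mulMat A hx)).const_mul _)

end SquareIntegrable

lemma measurable_stateOf {Ξ : Type v} [MeasurableSpace Ξ] {p : Params}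
    {A : Matrix (Fin dy) (Fin dx) ℝ} {Gf : Oracle rf rg Ξ dx} {Gg : Oracle rf rg Ξ dy}
    (hGf : ∀ k, Measurable fun q : History rf rg Ξ k × Vec dx × Ξ => Gf k q.1 q.2.1 q.2.2)
    (hGg : ∀ k, Measurable fun q : History rf rg Ξ k × Vec dy × Ξ => Gg k q.1 q.2.1 q.2.2)
    (x₀ : Vec dx) (y₀ : Vec dy) (k : ℕ) :
    State.IsMeasurable (stateOf p A Gf Gg x₀ y₀ k) := by
  induction k with
  | zero => exact ⟨measurable_const, measurable_const, measurable_const, measurable_const,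
      measurable_const⟩
  | succ k ih =>
    have hd : Measurable (History.dropLast : History rf rg Ξ (k + 1) → History rf rg Ξ k) := by
      unfold History.dropLast
      fun_prop
    have ih' : State.IsMeasurable fun h : History rf rg Ξ (k + 1) =>
        stateOf p A Gf Gg x₀ y₀ k h.dropLast :=
      ⟨ih.x.comp hd, ih.xf.comp hd, ih.y.comp hd, ih.yf.comp hd, ih.yprev.comp hd⟩
    refine ih'.step p A (measurable_batchMean fun i => ?_) (measurable_batchMean fun j => ?_)
    · exact (hGf k).comp (hd.prodMk ((ih'.xg p).prodMk (by fun_prop)))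
    · exact (hGg k).comp (hd.prodMk ((ih'.yg p).prodMk (by fun_prop)))

/-- Gradients and coupling terms never leave the ranges of `Aᵀ` and `A`. -/
lemma stateOf_x_mem_range {Ξ : Type v} {p : Params} {A : Matrix (Fin dy) (Fin dx) ℝ}
    {Gf : Oracle rf rg Ξ dx} {Gg : Oracle rf rg Ξ dy} {x₀ : Vec dx} {y₀ : Vec dy}
    (hG : ∀ k h z ζ, Gf k h z ζ ∈ LinearMap.range (mulMat Aᵀ))
    (hx₀ : x₀ ∈ LinearMap.range (mulMat Aᵀ)) (k : ℕ) (h : History rf rg Ξ k) :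
    (stateOf p A Gf Gg x₀ y₀ k h).x ∈ LinearMap.range (mulMat Aᵀ) ∧
      (stateOf p A Gf Gg x₀ y₀ k h).xf ∈ LinearMap.range (mulMat Aᵀ) := by
  induction k with
  | zero => exact ⟨hx₀, hx₀⟩
  | succ k ih =>
    obtain ⟨h1, h2⟩ := ih h.dropLast
    set s := stateOf p A Gf Gg x₀ y₀ k h.dropLast with hs
    set R := LinearMap.range (mulMat Aᵀ)
    have hxg : s.xg p ∈ R := R.add_mem (R.smul_mem _ h1) (R.smul_mem _ h2)
    have hx' : (stateOf p A Gf Gg x₀ y₀ (k + 1) h).x ∈ R :=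
      R.sub_mem (R.sub_mem (R.add_mem h1 (R.smul_mem _ (R.sub_mem hxg h1)))
        (R.smul_mem _ (LinearMap.mem_range_self _ _)))
        (R.smul_mem _ (R.add_mem (R.smul_mem _ (R.sum_mem fun i _ => hG _ _ _ _))
          (LinearMap.mem_range_self _ _)))
    exact ⟨hx', R.add_mem hxg (R.smul_mem _ (R.sub_mem hx' h1))⟩

lemma stateOf_y_mem_range {Ξ : Type v} {p : Params} {A : Matrix (Fin dy) (Fin dx) ℝ}
    {Gf : Oracle rf rg Ξ dx} {Gg : Oracle rf rg Ξ dy} {x₀ : Vec dx} {y₀ : Vec dy}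
    (hG : ∀ k h z ζ, Gg k h z ζ ∈ LinearMap.range (mulMat A))
    (hy₀ : y₀ ∈ LinearMap.range (mulMat A)) (k : ℕ) (h : History rf rg Ξ k) :
    (stateOf p A Gf Gg x₀ y₀ k h).y ∈ LinearMap.range (mulMat A) ∧
      (stateOf p A Gf Gg x₀ y₀ k h).yf ∈ LinearMap.range (mulMat A) := by
  induction k with
  | zero => exact ⟨hy₀, hy₀⟩
  | succ k ih =>
    obtain ⟨h1, h2⟩ := ih h.dropLast
    set s := stateOf p A Gf Gg x₀ y₀ k h.dropLast with hs
    set R := LinearMap.range (mulMat A)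
    have hyg : s.yg p ∈ R := R.add_mem (R.smul_mem _ h1) (R.smul_mem _ h2)
    have hy' : (stateOf p A Gf Gg x₀ y₀ (k + 1) h).y ∈ R :=
      R.sub_mem (R.sub_mem (R.add_mem h1 (R.smul_mem _ (R.sub_mem hyg h1)))
        (R.smul_mem _ (LinearMap.mem_range_self _ _)))
        (R.smul_mem _ (R.sub_mem (R.smul_mem _ (R.sum_mem fun i _ => hG _ _ _ _))
          (LinearMap.mem_range_self _ _)))
    exact ⟨hy', R.add_mem hyg (R.smul_mem _ (R.sub_mem hy' h1))⟩

end Iterates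

/-! ### The noise of a batch -/

section BatchNoise

variable {rf rg r d k : ℕ} {Ω : Type u} {Ξ : Type v} [MeasurableSpace Ω] [MeasurableSpace Ξ]
  {P : Measure Ω} {ξx : ℕ → Fin rf → Ω → Ξ} {ξy : ℕ → Fin rg → Ω → Ξ}

/-- The mean of a batched gradient given the past. -/
noncomputable def batchCondMean {𝓗 : Type*} (P : Measure Ω) (ζ : Fin r → Ω → Ξ)
    (F : 𝓗 → Ξ → Vec d) (H : 𝓗) : Vec d :=
  batchMean fun i => condMean P (ζ i) F H

/-- The noise of a batched gradient. -/
noncomputable def batchNoise {𝓗 : Type*} (P : Measure Ω) (ζ : Fin r → Ω → Ξ)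
    (F : 𝓗 → Ξ → Vec d) (H : Ω → 𝓗) (ω : Ω) : Vec d :=
  batchMean fun i => condNoise P (ζ i) F (H ω) (ζ i ω)

lemma batchCondMean_add_batchNoise {𝓗 : Type*} (ζ : Fin r → Ω → Ξ) (F : 𝓗 → Ξ → Vec d)
    (H : Ω → 𝓗) (ω : Ω) : batchCondMean P ζ F (H ω) + batchNoise P ζ F H ω =
      batchMean fun i => F (H ω) (ζ i ω) := by
  rw [batchCondMean, batchNoise, ← batchMean_add]
  simp [condNoise]

/-- A batch of stochastic models, drawn at iteration `k` at the positions `ι` of the family of all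
samples. -/
structure IsBatch (P : Measure Ω) (ξx : ℕ → Fin rf → Ω → Ξ) (ξy : ℕ → Fin rg → Ω → Ξ) (k : ℕ)
    (ι : Fin r → ℕ × Fin rf ⊕ ℕ × Fin rg) (F : History rf rg Ξ k → Ξ → Vec d) (h : Vec d → ℝ)
    (L μ σ : ℝ) (Δ : History rf rg Ξ k → ℝ) (X : Ω → Vec d) : Prop where
  sampling : SamplingAssumption P ξx ξy
  injective : Function.Injective ι
  time : ∀ i, sampleTime (ι i) = k
  measurable : Measurable (Function.uncurry F)
  model : ∀ i, ∀ᵐ ω ∂P, IsStochasticModel h (Δ (history ξx ξy k ω)) L μ σ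
    (P.map (allSamples ξx ξy (ι i))) (F (history ξx ξy k ω)) (X ω)

variable {ι : Fin r → ℕ × Fin rf ⊕ ℕ × Fin rg} {F : History rf rg Ξ k → Ξ → Vec d}
  {h : Vec d → ℝ} {L μ σ : ℝ} {Δ : History rf rg Ξ k → ℝ} {X : Ω → Vec d}

lemma IsBatch.isInexactModel (hb : IsBatch P ξx ξy k ι F h L μ σ Δ X) (hr : 0 < r) :
    ∀ᵐ ω ∂P, IsInexactModel h (Δ (history ξx ξy k ω)) L μ (X ω)
      (batchCondMean P (fun i => allSamples ξx ξy (ι i)) F (history ξx ξy k ω)) := by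
  filter_upwards [ae_all_iff.2 hb.model] with ω hω
  exact IsInexactModel.batchMean hr fun i => (hω i).2.1

variable [IsProbabilityMeasure P]

lemma IsBatch.memLp_condNoise (hb : IsBatch P ξx ξy k ι F h L μ σ Δ X) (i : Fin r) :
    MemLp (fun ω => condNoise P (allSamples ξx ξy (ι i)) F (history ξx ξy k ω)
      (allSamples ξx ξy (ι i) ω)) 2 P ∧
    ∫ ω, ‖condNoise P (allSamples ξx ξy (ι i)) F (history ξx ξy k ω)
      (allSamples ξx ξy (ι i) ω)‖ ^ 2 ∂P ≤ σ ^ 2 :=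
  APDG.memLp_condNoise (hb.sampling.measurable_history k) (hb.sampling.measurable_allSamples _)
    (hb.sampling.indepFun_history (hb.time i).ge) hb.measurable (hb.model i)

lemma IsBatch.memLp_batchNoise (hb : IsBatch P ξx ξy k ι F h L μ σ Δ X) :
    MemLp (batchNoise P (fun i => allSamples ξx ξy (ι i)) F (history ξx ξy k)) 2 P :=
  memLp_batchMean fun i => (hb.memLp_condNoise i).1

lemma measurable_batchCondMean (ζ : Fin r → Ω → Ξ) (hF : Measurable (Function.uncurry F)) :
    Measurable (batchCondMean P ζ F) :=
  measurable_batchMean fun _ => measurable_condMean hF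

lemma IsBatch.memLp_batchCondMean (hb : IsBatch P ξx ξy k ι F h L μ σ Δ X) (hL : 0 < L)
    (hμ : 0 ≤ μ) (hc : MuStronglyConvex μ h) (hs : LSmooth L h) (hX : MemLp X 2 P)
    (hΔ : Integrable (fun ω => Δ (history ξx ξy k ω)) P) :
    MemLp (fun ω => batchCondMean P (fun i => allSamples ξx ξy (ι i)) F (history ξx ξy k ω)) 2 P :=
  memLp_batchMean fun i => memLp_condMean hL hμ hc hs (hb.sampling.measurable_history k)
    hb.measurable hX hΔ (hb.model i)

/-- The noise of a batch is uncorrelated with functions of the past and one further sample. -/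
lemma IsBatch.integral_inner_condNoise_sample (hb : IsBatch P ξx ξy k ι F h L μ σ Δ X) (i : Fin r)
    {b : ℕ × Fin rf ⊕ ℕ × Fin rg} (hbi : b ≠ ι i) {U : History rf rg Ξ k × Ξ → Vec d}
    (hU : Measurable U)
    (hUi : MemLp (fun ω => U (history ξx ξy k ω, allSamples ξx ξy b ω)) 2 P) :
    ∫ ω, ⟪condNoise P (allSamples ξx ξy (ι i)) F (history ξx ξy k ω) (allSamples ξx ξy (ι i) ω),
      U (history ξx ξy k ω, allSamples ξx ξy b ω)⟫ ∂P = 0 :=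
  integral_inner_condNoise_eq_zero (π := Prod.fst)
    ((hb.sampling.measurable_history k).prodMk (hb.sampling.measurable_allSamples b))
    measurable_fst (fun _ => rfl) (hb.sampling.measurable_allSamples _)
    (hb.sampling.indepFun_history_prod (hb.time i).ge hbi) hb.measurable (hb.model i) hU hUi

lemma IsBatch.integral_inner_sample (hb : IsBatch P ξx ξy k ι F h L μ σ Δ X)
    {b : ℕ × Fin rf ⊕ ℕ × Fin rg} (hbi : ∀ i, b ≠ ι i) {U : History rf rg Ξ k × Ξ → Vec d}
    (hU : Measurable U)
    (hUi : MemLp (fun ω => U (history ξx ξy k ω, allSamples ξx ξy b ω)) 2 P) :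
    ∫ ω, ⟪batchNoise P (fun i => allSamples ξx ξy (ι i)) F (history ξx ξy k) ω,
      U (history ξx ξy k ω, allSamples ξx ξy b ω)⟫ ∂P = 0 :=
  integral_inner_batchMean_eq_zero (fun i => (hb.memLp_condNoise i).1) hUi
    fun i => hb.integral_inner_condNoise_sample i (hbi i) hU hUi

lemma IsBatch.integral_inner_history (hb : IsBatch P ξx ξy k ι F h L μ σ Δ X)
    {U : History rf rg Ξ k → Vec d} (hU : Measurable U)
    (hUi : MemLp (fun ω => U (history ξx ξy k ω)) 2 P) :
    ∫ ω, ⟪batchNoise P (fun i => allSamples ξx ξy (ι i)) F (history ξx ξy k) ω,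
      U (history ξx ξy k ω)⟫ ∂P = 0 :=
  integral_inner_batchMean_eq_zero (fun i => (hb.memLp_condNoise i).1) hUi
    fun i => integral_inner_condNoise_eq_zero (π := id) (hb.sampling.measurable_history k)
      measurable_id (fun _ => rfl) (hb.sampling.measurable_allSamples _)
      (hb.sampling.indepFun_history (hb.time i).ge) hb.measurable (hb.model i) hU hUi

lemma IsBatch.integral_norm_sq_le (hb : IsBatch P ξx ξy k ι F h L μ σ Δ X) :
    ∫ ω, ‖batchNoise P (fun i => allSamples ξx ξy (ι i)) F (history ξx ξy k) ω‖ ^ 2 ∂P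
      ≤ σ ^ 2 / r :=
  integral_norm_batchMean_sq_le (fun i => (hb.memLp_condNoise i).1)
    (fun i j hij => hb.integral_inner_condNoise_sample i (hb.injective.ne hij.symm)
      (U := fun q => condNoise P (allSamples ξx ξy (ι j)) F q.1 q.2)
      (measurable_condNoise hb.measurable) (hb.memLp_condNoise j).1)
    fun i => (hb.memLp_condNoise i).2

end BatchNoise

/-! ### Contraction in expectation -/

section Expectation

variable {dx dy : ℕ} {c : Constants} {w : ℝ} {p : Params} {A : Matrix (Fin dy) (Fin dx) ℝ}
  {f : Vec dx → ℝ} {g : Vec dy → ℝ} {xs : Vec dx} {ys : Vec dy}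
  {Ω : Type*} [MeasurableSpace Ω] {P : Measure Ω} [IsProbabilityMeasure P]
  {S : Ω → State dx dy} {sf ef : Ω → Vec dx} {sg eg : Ω → Vec dy}

lemma State.IsSquareIntegrable.memLp_noiseDualX (hS : State.IsSquareIntegrable P S)
    (hsf : MemLp sf 2 P) (hsg : MemLp sg 2 P) :
    MemLp (fun ω => noiseDualX p A f xs (S ω) (sf ω) (sg ω)) 2 P :=
  (((hS.step p A hsf hsg).x.sub (memLp_const xs)).const_smul (-(2 : ℝ))).add
    ((hsf.sub (memLp_const (∇ f xs))).const_smul (2 * p.βy))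

lemma State.IsSquareIntegrable.memLp_noiseDualY (hS : State.IsSquareIntegrable P S)
    (hsf : MemLp sf 2 P) (hsg : MemLp sg 2 P) :
    MemLp (fun ω => noiseDualY p A g ys (S ω) (sf ω) (sg ω)) 2 P :=
  (((hS.step p A hsf hsg).y.sub (memLp_const ys)).const_smul (-(2 : ℝ))).add
    ((hsg.sub (memLp_const (∇ g ys))).const_smul (2 * p.βx))

lemma State.IsMeasurable.noiseDualX {𝓗 : Type*} [MeasurableSpace 𝓗] {T : 𝓗 → State dx dy}
    (hT : State.IsMeasurable T) {sf : 𝓗 → Vec dx} {sg : 𝓗 → Vec dy} (hsf : Measurable sf)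
    (hsg : Measurable sg) : Measurable fun h => noiseDualX p A f xs (T h) (sf h) (sg h) :=
  (((hT.step p A hsf hsg).x.sub measurable_const).const_smul (-(2 : ℝ))).add
    ((hsf.sub (measurable_const (a := ∇ f xs))).const_smul (2 * p.βy))

lemma State.IsMeasurable.noiseDualY {𝓗 : Type*} [MeasurableSpace 𝓗] {T : 𝓗 → State dx dy}
    (hT : State.IsMeasurable T) {sf : 𝓗 → Vec dx} {sg : 𝓗 → Vec dy} (hsf : Measurable sf)
    (hsg : Measurable sg) : Measurable fun h => noiseDualY p A g ys (T h) (sf h) (sg h) :=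
  (((hT.step p A hsf hsg).y.sub measurable_const).const_smul (-(2 : ℝ))).add
    ((hsg.sub (measurable_const (a := ∇ g ys))).const_smul (2 * p.βx))

/-- Uncorrelated noise contributes only its second moments. -/
lemma integral_noiseTerm_le (hv : p.Valid c) (hS : State.IsSquareIntegrable P S)
    (hsf : MemLp sf 2 P) (hsg : MemLp sg 2 P) (hef : MemLp ef 2 P) (heg : MemLp eg 2 P)
    (hUf : ∫ ω, ⟪ef ω, noiseDualX p A f xs (S ω) (sf ω) (sg ω)⟫ ∂P = 0)
    (hUg : ∫ ω, ⟪eg ω, noiseDualY p A g ys (S ω) (sf ω) (sg ω)⟫ ∂P = 0)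
    (hfg : ∫ ω, ⟪mulMat A (ef ω), eg ω⟫ ∂P = 0) {Vf Vg : ℝ}
    (hVf : ∫ ω, ‖ef ω‖ ^ 2 ∂P ≤ Vf) (hVg : ∫ ω, ‖eg ω‖ ^ 2 ∂P ≤ Vg) :
    Integrable (fun ω => noiseTerm p A f g xs ys (S ω) (sf ω) (ef ω) (sg ω) (eg ω)) P ∧
      ∫ ω, noiseTerm p A f g xs ys (S ω) (sf ω) (ef ω) (sg ω) (eg ω) ∂P ≤
        (2 * p.ηx + p.βy) * Vf + (2 * p.ηy + p.βx) * Vg := by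
  have i1 := integrable_inner_of_memLp hef
    (hS.memLp_noiseDualX (p := p) (A := A) (f := f) (xs := xs) hsf hsg)
  have i2 := integrable_inner_of_memLp heg
    (hS.memLp_noiseDualY (p := p) (A := A) (g := g) (ys := ys) hsf hsg)
  have i3 := (integrable_inner_of_memLp (memLp_mulMat A hef) heg).const_mul
    (-2 * p.ηx * p.βx + 2 * p.ηy * p.βy + 2 * p.ηy * p.ηx)
  have i4 := (hef.integrable_norm_pow two_ne_zero).const_mul (2 * p.ηx + p.βy)
  have i5 := (heg.integrable_norm_pow two_ne_zero).const_mul (2 * p.ηy + p.βx)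
  have hi := (((i1.add i2).add i3).add i4).add i5
  refine ⟨hi, ?_⟩
  have e : ∫ ω, noiseTerm p A f g xs ys (S ω) (sf ω) (ef ω) (sg ω) (eg ω) ∂P =
      (2 * p.ηx + p.βy) * ∫ ω, ‖ef ω‖ ^ 2 ∂P + (2 * p.ηy + p.βx) * ∫ ω, ‖eg ω‖ ^ 2 ∂P := by
    have h5 := integral_add (((i1.add i2).add i3).add i4) i5
    rw [integral_add' ((i1.add i2).add i3) i4, integral_add' (i1.add i2) i3,
      integral_add' i1 i2, hUf, hUg] at h5
    rw [integral_const_mul, integral_const_mul, integral_const_mul, hfg] at h5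
    rw [mul_zero, add_zero, add_zero, zero_add] at h5
    exact h5
  rw [e]
  have := hv.ηx_pos; have := hv.ηy_pos; have := hv.βx_pos; have := hv.βy_pos
  gcongr

lemma Params.Contracting.integral_lyapunov_step_le (hc : c.Admissible) (hv : p.Valid c)
    (hp : p.Contracting c w) (hf : MuStronglyConvex c.μx f) (hfL : LSmooth c.Lx f)
    (hg : MuStronglyConvex c.μy g) (hgL : LSmooth c.Ly g)
    (hA : ∀ v, ‖mulMat A v‖ ≤ c.Lxy * ‖v‖) (hA' : ∀ v, ‖mulMat Aᵀ v‖ ≤ c.Lxy * ‖v‖)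
    (hfs : ∇ f xs = - mulMat Aᵀ ys) (hgs : ∇ g ys = mulMat A xs)
    (hS : State.IsSquareIntegrable P S)
    (hx : ∀ ω, c.μyx ^ 2 * ‖(S ω).x - xs‖ ^ 2 ≤ ‖mulMat A ((S ω).x - xs)‖ ^ 2)
    (hy : ∀ ω, c.μxy ^ 2 * ‖(S ω).y - ys‖ ^ 2 ≤ ‖mulMat Aᵀ ((S ω).y - ys)‖ ^ 2)
    {Dx Dy : Ω → ℝ} (hDx : Integrable Dx P) (hDy : Integrable Dy P)
    (hmf : ∀ᵐ ω ∂P, IsInexactModel f (Dx ω) c.Lx c.μx ((S ω).xg p) (sf ω))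
    (hmg : ∀ᵐ ω ∂P, IsInexactModel g (Dy ω) c.Ly c.μy ((S ω).yg p) (sg ω))
    (hsf : MemLp sf 2 P) (hsg : MemLp sg 2 P) (hef : MemLp ef 2 P) (heg : MemLp eg 2 P)
    (hUf : ∫ ω, ⟪ef ω, noiseDualX p A f xs (S ω) (sf ω) (sg ω)⟫ ∂P = 0)
    (hUg : ∫ ω, ⟪eg ω, noiseDualY p A g ys (S ω) (sf ω) (sg ω)⟫ ∂P = 0)
    (hfg : ∫ ω, ⟪mulMat A (ef ω), eg ω⟫ ∂P = 0) {Vf Vg : ℝ}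
    (hVf : ∫ ω, ‖ef ω‖ ^ 2 ∂P ≤ Vf) (hVg : ∫ ω, ‖eg ω‖ ^ 2 ∂P ≤ Vg) :
    ∫ ω, lyapunov p A f g xs ys
        (step p A (fun _ => sf ω + ef ω) (fun _ => sg ω + eg ω) (S ω)) ∂P ≤
      p.θ * ∫ ω, lyapunov p A f g xs ys (S ω) ∂P
        + 4 / (1 - p.θ) * (∫ ω, Dx ω ∂P + ∫ ω, Dy ω ∂P)
        + ((2 * p.ηx + p.βy) * Vf + (2 * p.ηy + p.βx) * Vg) := by
  obtain ⟨hni, hn⟩ := integral_noiseTerm_le (xs := xs) (ys := ys) hv hS hsf hsg hef heg hUf hUg hfg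
    hVf hVg
  have hΨ := hS.integrable_lyapunov hc p A hf hfL hg hgL xs ys
  have hΨ' := (hS.step p A (hsf.add hef) (hsg.add heg)).integrable_lyapunov hc p A hf hfL hg hgL
    xs ys
  have iD := (hDx.add hDy).const_mul (4 / (1 - p.θ))
  have iΨ := hΨ.const_mul p.θ
  have h1 := integral_mono_ae hΨ' ((iΨ.add iD).add hni) (by
    filter_upwards [hmf, hmg] with ω h1 h2
    exact hp.lyapunov_step_le hc hv hf hg hA hA' hfs hgs (hx ω) (hy ω) h1 h2)
  rw [integral_add' (iΨ.add iD) hni, integral_add' iΨ iD, integral_const_mul,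
    integral_const_mul] at h1
  have e : ∫ ω, (Dx + Dy) ω ∂P = ∫ ω, Dx ω ∂P + ∫ ω, Dy ω ∂P := integral_add' hDx hDy
  rw [e] at h1
  refine h1.trans ?_
  gcongr

/-- The parameters make the coefficients of the variances those of `Σ² / 2`. -/
lemma Params.Contracting.noise_le_sigmaSq (hc : c.Admissible) (hp : p.Contracting c w)
    (σf σg : ℝ) (rf rg : ℕ) :
    (2 * p.ηx + p.βy) * (σf ^ 2 / rf) + (2 * p.ηy + p.βx) * (σg ^ 2 / rg) ≤
      sigmaSq c w σf σg rf rg / 2 := by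
  have hL := hc.Lxy_pos; have hLx := hc.Lx_pos; have hLy := hc.Ly_pos
  have hw := hp.w_pos
  have h1 := hp.ηx_coupling
  have h2 := hp.ηy_coupling
  have h3 : p.βx ≤ 1 / (2 * c.Ly) := (le_div_iff₀ (by positivity)).2 hp.βx_smooth
  have h4 : p.βy ≤ 1 / (2 * c.Lx) := (le_div_iff₀ (by positivity)).2 hp.βy_smooth
  have e1 : (1 / c.Lx + w / c.Lxy) / 2 = 2 * (w / (4 * c.Lxy)) + 1 / (2 * c.Lx) := by
    field_simp; ring
  have e2 : (1 / c.Ly + 1 / (c.Lxy * w)) / 2 = 2 * (1 / (4 * c.Lxy * w)) + 1 / (2 * c.Ly) := by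
    field_simp; ring
  have h5 : 2 * p.ηx + p.βy ≤ (1 / c.Lx + w / c.Lxy) / 2 := by rw [e1]; linarith
  have h6 : 2 * p.ηy + p.βx ≤ (1 / c.Ly + 1 / (c.Lxy * w)) / 2 := by rw [e2]; linarith
  have h7 := mul_le_mul_of_nonneg_right h5 (by positivity : 0 ≤ σf ^ 2 / rf)
  have h8 := mul_le_mul_of_nonneg_right h6 (by positivity : 0 ≤ σg ^ 2 / rg)
  unfold sigmaSq
  linarith

end Expectation

/-- Unrolling of a linear recursion. -/
lemma le_of_recursion {θ E : ℝ} (hθ : θ ∈ Set.Ioo (0 : ℝ) 1) (hE : 0 ≤ E) {a : ℕ → ℝ}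
    (h : ∀ k, a (k + 1) ≤ θ * a k + E) (k : ℕ) : a k ≤ θ ^ k * a 0 + E / (1 - θ) := by
  have hθ' : 0 < 1 - θ := by linarith [hθ.2]
  induction k with
  | zero => simpa using div_nonneg hE hθ'.le
  | succ k ih =>
    have h1 := mul_le_mul_of_nonneg_left ih hθ.1.le
    have h2 : θ * (E / (1 - θ)) + E = E / (1 - θ) := by field_simp; ring
    rw [pow_succ]
    linarith [h k]

/-! ### Convergence for contracting parameters -/

/-- The two coupling inequalities with the norm of `A`. -/
lemma CouplingAssumption.norm_le {dx dy rf rg : ℕ} {Ξ : Type v} {c : Constants}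
    {A : Matrix (Fin dy) (Fin dx) ℝ} {f : Vec dx → ℝ} {g : Vec dy → ℝ} {Gf : Oracle rf rg Ξ dx}
    {Gg : Oracle rf rg Ξ dy} (h : CouplingAssumption c A f g Gf Gg) (hc : c.Admissible) :
    (∀ v, ‖mulMat A v‖ ≤ c.Lxy * ‖v‖) ∧ ∀ v, ‖mulMat Aᵀ v‖ ≤ c.Lxy * ‖v‖ :=
  ⟨norm_mulMat_le hc.Lxy_pos h.Lxy_bound, norm_mulMat_transpose_le hc.Lxy_pos h.Lxy_bound⟩

lemma lyapunov_init_le {dx dy : ℕ} {c : Constants} {p : Params} (hv : p.Valid c)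
    {A : Matrix (Fin dy) (Fin dx) ℝ} {f : Vec dx → ℝ} {g : Vec dy → ℝ} (hf : LSmooth c.Lx f)
    (hg : LSmooth c.Ly g) (xs x₀ : Vec dx) (ys y₀ : Vec dy) :
    lyapunov p A f g xs ys (State.init x₀ y₀) ≤
      (1 / p.ηx + c.Lx / p.σx) * ‖x₀ - xs‖ ^ 2 + (1 / p.ηy + c.Ly / p.σy) * ‖y₀ - ys‖ ^ 2 := by
  have hσx := hv.σx_mem.1
  have hσy := hv.σy_mem.1
  have h1 := mul_le_mul_of_nonneg_left (bregman_le hf x₀ xs) (by positivity : 0 ≤ 2 / p.σx)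
  have h2 := mul_le_mul_of_nonneg_left (bregman_le hg y₀ ys) (by positivity : 0 ≤ 2 / p.σy)
  have e1 : 2 / p.σx * (c.Lx / 2 * ‖x₀ - xs‖ ^ 2) = c.Lx / p.σx * ‖x₀ - xs‖ ^ 2 := by field_simp
  have e2 : 2 / p.σy * (c.Ly / 2 * ‖y₀ - ys‖ ^ 2) = c.Ly / p.σy * ‖y₀ - ys‖ ^ 2 := by field_simp
  simp only [lyapunov, State.init, sub_self, norm_zero, inner_zero_left]
  linarith

theorem Params.Contracting.converges {c : Constants} {w : ℝ} {p : Params} (hc : c.Admissible)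
    (hv : p.Valid c) (hp : p.Contracting c w) : Converges.{u, v} c w p := by
  intro dx dy rf rg _ _ hrf hrg A f g hf hfL hg hgL hsol Ω _ P _ Ξ _ ξx ξy Gf Gg Δx Δy δx δy σf σg
    x₀ y₀ hsamp hcoup hx₀ hy₀ S hOf hOg
  refine ⟨exists_isNormalisedSolution hf.1 hg.1 hsol, fun xs ys hs => ?_⟩
  intro Ψ Ψ₀ Sig
  refine ⟨lyapunov_init_le hv hfL hgL xs x₀ ys y₀, ?_⟩
  obtain ⟨hA, hA'⟩ := hcoup.norm_le hc
  have hfs := hs.1.gradient_f hf.1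
  have hgs := hs.1.gradient_g hg.1
  -- the state as a function of the past
  let T : (k : ℕ) → History rf rg Ξ k → State dx dy := stateOf p A Gf Gg x₀ y₀
  have hST : ∀ k ω, S k ω = T k (history ξx ξy k ω) :=
    iterate_eq_stateOf p A Gf Gg ξx ξy x₀ y₀
  have hT : ∀ k, State.IsMeasurable (T k) := measurable_stateOf hOf.measurable hOg.measurable x₀ y₀
  have hx : ∀ k ω, c.μyx ^ 2 * ‖(S k ω).x - xs‖ ^ 2 ≤ ‖mulMat A ((S k ω).x - xs)‖ ^ 2 := by
    intro k ω
    refine sq_mul_norm_sq_le A hcoup.μyx_bound_pos hcoup.μyx_bound fun hG => ?_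
    rw [hST]
    exact Submodule.sub_mem _ (stateOf_x_mem_range hG.2 hx₀ k _).1 (hs.2.1 hG)
  have hy : ∀ k ω, c.μxy ^ 2 * ‖(S k ω).y - ys‖ ^ 2 ≤ ‖mulMat Aᵀ ((S k ω).y - ys)‖ ^ 2 := by
    intro k ω
    have h1 := hcoup.μxy_bound_pos
    have h2 := hcoup.μxy_bound
    rw [← Matrix.transpose_transpose A, Matrix.transpose_transpose Aᵀ] at h1 h2
    refine sq_mul_norm_sq_le Aᵀ h1 h2 fun hG => ?_
    rw [Matrix.transpose_transpose, hST]
    rw [Matrix.transpose_transpose] at hG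
    exact Submodule.sub_mem _ (stateOf_y_mem_range hG.2 hy₀ k _).1 (hs.2.2 hG)
  -- the batches of both oracles
  let Ff : (k : ℕ) → History rf rg Ξ k → Ξ → Vec dx := fun k h z => Gf k h ((T k h).xg p) z
  let Fg : (k : ℕ) → History rf rg Ξ k → Ξ → Vec dy := fun k h z => Gg k h ((T k h).yg p) z
  have hbf : ∀ k, IsBatch P ξx ξy k (fun i : Fin rf => Sum.inl (k, i)) (Ff k) f c.Lx c.μx σf (Δx k)
      (fun ω => (S k ω).xg p) := fun k =>
    { sampling := hsamp
      injective := fun i j h => by simpa using h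
      time := fun _ => rfl
      measurable := (hOf.measurable k).comp
        (measurable_fst.prodMk ((((hT k).xg p).comp measurable_fst).prodMk measurable_snd))
      model := fun i => by
        filter_upwards [hOf.model k i] with ω hω
        simp only [hST] at hω ⊢
        exact hω }
  have hbg : ∀ k, IsBatch P ξx ξy k (fun j : Fin rg => Sum.inr (k, j)) (Fg k) g c.Ly c.μy σg (Δy k)
      (fun ω => (S k ω).yg p) := fun k =>
    { sampling := hsamp
      injective := fun i j h => by simpa using h
      time := fun _ => rfl
      measurable := (hOg.measurable k).comp
        (measurable_fst.prodMk ((((hT k).yg p).comp measurable_fst).prodMk measurable_snd))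
      model := fun i => by
        filter_upwards [hOg.model k i] with ω hω
        simp only [hST] at hω ⊢
        exact hω }
  let mf : (k : ℕ) → History rf rg Ξ k → Vec dx := fun k => batchCondMean P (ξx k) (Ff k)
  let mg : (k : ℕ) → History rf rg Ξ k → Vec dy := fun k => batchCondMean P (ξy k) (Fg k)
  let ef : ℕ → Ω → Vec dx := fun k => batchNoise P (ξx k) (Ff k) (history ξx ξy k)
  let eg : ℕ → Ω → Vec dy := fun k => batchNoise P (ξy k) (Fg k) (history ξx ξy k)
  have hef : ∀ k, MemLp (ef k) 2 P := fun k => (hbf k).memLp_batchNoise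
  have heg : ∀ k, MemLp (eg k) 2 P := fun k => (hbg k).memLp_batchNoise
  have hmfm : ∀ k, Measurable (mf k) := fun k => measurable_batchCondMean (ξx k) (hbf k).measurable
  have hmgm : ∀ k, Measurable (mg k) := fun k => measurable_batchCondMean (ξy k) (hbg k).measurable
  have hstep : ∀ k ω, S (k + 1) ω = step p A (fun _ => mf k (history ξx ξy k ω) + ef k ω)
      (fun _ => mg k (history ξx ξy k ω) + eg k ω) (S k ω) := by
    intro k ω
    rw [batchCondMean_add_batchNoise, batchCondMean_add_batchNoise]
    simp only [Ff, Fg, ← hST]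
    rfl
  -- square integrability propagates along the iteration
  have hmf : ∀ k, State.IsSquareIntegrable P (S k) →
      MemLp (fun ω => mf k (history ξx ξy k ω)) 2 P := fun k hS =>
    (hbf k).memLp_batchCondMean hc.Lx_pos hc.μx_nonneg hf hfL (hS.xg p) (hOf.integrable k)
  have hmg : ∀ k, State.IsSquareIntegrable P (S k) →
      MemLp (fun ω => mg k (history ξx ξy k ω)) 2 P := fun k hS =>
    (hbg k).memLp_batchCondMean hc.Ly_pos hc.μy_nonneg hg hgL (hS.yg p) (hOg.integrable k)
  have hS : ∀ k, State.IsSquareIntegrable P (S k) := by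
    intro k
    induction k with
    | zero => exact ⟨memLp_const _, memLp_const _, memLp_const _, memLp_const _, memLp_const _⟩
    | succ k ih =>
      have h := ih.step p A ((hmf k ih).add (hef k)) ((hmg k ih).add (heg k))
      rw [funext (hstep k)]
      exact h
  have hΨ : ∀ k, Integrable (fun ω => Ψ (S k ω)) P := fun k =>
    (hS k).integrable_lyapunov hc p A hf hfL hg hgL xs ys
  have hθ := hv.θ_mem
  have hθ1 : 0 < 1 - p.θ := by linarith [hθ.2]
  -- contraction
  have hrec : ∀ k, ∫ ω, Ψ (S (k + 1) ω) ∂P ≤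
      p.θ * ∫ ω, Ψ (S k ω) ∂P + 4 / (1 - p.θ) * (δx + δy) + Sig / 2 := by
    intro k
    have hUf : ∫ ω, ⟪ef k ω, noiseDualX p A f xs (S k ω) (mf k (history ξx ξy k ω))
        (mg k (history ξx ξy k ω))⟫ ∂P = 0 := by
      have hi := (hS k).memLp_noiseDualX (p := p) (A := A) (f := f) (xs := xs) (hmf k (hS k))
        (hmg k (hS k))
      simp only [hST] at hi ⊢
      exact (hbf k).integral_inner_history
        (U := fun h => noiseDualX p A f xs (T k h) (mf k h) (mg k h))
        ((hT k).noiseDualX (hmfm k) (hmgm k)) hi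
    have hUg : ∫ ω, ⟪eg k ω, noiseDualY p A g ys (S k ω) (mf k (history ξx ξy k ω))
        (mg k (history ξx ξy k ω))⟫ ∂P = 0 := by
      have hi := (hS k).memLp_noiseDualY (p := p) (A := A) (g := g) (ys := ys) (hmf k (hS k))
        (hmg k (hS k))
      simp only [hST] at hi ⊢
      exact (hbg k).integral_inner_history
        (U := fun h => noiseDualY p A g ys (T k h) (mf k h) (mg k h))
        ((hT k).noiseDualY (hmfm k) (hmgm k)) hi
    have hfg : ∫ ω, ⟪mulMat A (ef k ω), eg k ω⟫ ∂P = 0 := by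
      simp only [real_inner_comm (eg k _)]
      refine integral_inner_batchMean_eq_zero (fun j => ((hbg k).memLp_condNoise j).1)
        (memLp_mulMat A (hef k)) fun j => ?_
      simp only [real_inner_comm (mulMat A _), inner_mulMat]
      exact (hbf k).integral_inner_sample (b := Sum.inr (k, j)) (fun i => by simp)
        (U := fun q => mulMat Aᵀ (condNoise P (ξy k j) (Fg k) q.1 q.2))
        ((measurable_mulMat Aᵀ).comp (measurable_condNoise (hbg k).measurable))
        (memLp_mulMat Aᵀ ((hbg k).memLp_condNoise j).1)
    have h1 := hp.integral_lyapunov_step_le (xs := xs) (ys := ys) hc hv hf hfL hg hgL hA hA' hfs hgs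
      (hS k) (hx k) (hy k) (hOf.integrable k) (hOg.integrable k) ((hbf k).isInexactModel hrf)
      ((hbg k).isInexactModel hrg) (hmf k (hS k)) (hmg k (hS k)) (hef k) (heg k) hUf hUg hfg
      (hbf k).integral_norm_sq_le (hbg k).integral_norm_sq_le
    have h2 := hp.noise_le_sigmaSq hc σf σg rf rg
    have h3 : 4 / (1 - p.θ) * (∫ ω, Δx k (history ξx ξy k ω) ∂P
        + ∫ ω, Δy k (history ξx ξy k ω) ∂P) ≤ 4 / (1 - p.θ) * (δx + δy) := by
      have := hOf.mean_le k
      have := hOg.mean_le k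
      gcongr
    simp only [hstep k]
    exact h1.trans (add_le_add (add_le_add le_rfl h3) h2)
  -- the error of one iteration is nonnegative
  have hδx : 0 ≤ δx := by
    refine (integral_nonneg_of_ae ?_).trans (hOf.mean_le 0)
    filter_upwards [(hbf 0).isInexactModel hrf] with ω hω using hω.nonneg
  have hδy : 0 ≤ δy := by
    refine (integral_nonneg_of_ae ?_).trans (hOg.mean_le 0)
    filter_upwards [(hbg 0).isInexactModel hrg] with ω hω using hω.nonneg
  have hSig : 0 ≤ Sig := by
    have := hc.Lx_pos; have := hc.Ly_pos; have := hc.Lxy_pos; have := hp.w_pos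
    simp only [Sig, sigmaSq]
    positivity
  have hbound : ∀ k, ∫ ω, Ψ (S k ω) ∂P ≤ errorBound p.θ Ψ₀ (δx + δy) Sig k := by
    intro k
    have h1 := le_of_recursion hθ (E := 4 / (1 - p.θ) * (δx + δy) + Sig / 2) (by positivity)
      (a := fun k => ∫ ω, Ψ (S k ω) ∂P) (fun k => by linarith [hrec k]) k
    have h0 : ∫ ω, Ψ (S 0 ω) ∂P = Ψ₀ := by
      simp [S, iterate, Ψ₀]
    have e : (4 / (1 - p.θ) * (δx + δy) + Sig / 2) / (1 - p.θ) =
        4 / (1 - p.θ) ^ 2 * (δx + δy) + Sig / (2 * (1 - p.θ)) := by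
      field_simp
    simp only [h0, e] at h1
    unfold errorBound
    linarith
  intro k
  have hL := hc.Lxy_pos
  have hw := hp.w_pos
  have hix : Integrable (fun ω => ‖(S k ω).x - xs‖ ^ 2) P :=
    ((hS k).x.sub (memLp_const xs)).integrable_norm_pow two_ne_zero
  have hiy : Integrable (fun ω => ‖(S k ω).y - ys‖ ^ 2) P :=
    ((hS k).y.sub (memLp_const ys)).integrable_norm_pow two_ne_zero
  have hdist : 3 * c.Lxy / w * ∫ ω, ‖(S k ω).x - xs‖ ^ 2 ∂P
      + 4 * c.Lxy * w * ∫ ω, ‖(S k ω).y - ys‖ ^ 2 ∂P ≤ errorBound p.θ Ψ₀ (δx + δy) Sig k := by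
    rw [← integral_const_mul, ← integral_const_mul,
      ← integral_add (hix.const_mul _) (hiy.const_mul _)]
    exact (integral_mono ((hix.const_mul _).add (hiy.const_mul _)) (hΨ k)
      fun ω => hp.le_lyapunov hc hv hf hg hA (S k ω)).trans (hbound k)
  have hx0 : 0 ≤ ∫ ω, ‖(S k ω).x - xs‖ ^ 2 ∂P := integral_nonneg fun _ => sq_nonneg _
  have hy0 : 0 ≤ ∫ ω, ‖(S k ω).y - ys‖ ^ 2 ∂P := integral_nonneg fun _ => sq_nonneg _
  refine ⟨⟨hix, ?_⟩, ⟨hiy, ?_⟩, hΨ k, hrec k⟩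
  · have h1 : 0 ≤ 4 * c.Lxy * w * ∫ ω, ‖(S k ω).y - ys‖ ^ 2 ∂P := by positivity
    have h2 : 3 * c.Lxy / w * ∫ ω, ‖(S k ω).x - xs‖ ^ 2 ∂P ≤ errorBound p.θ Ψ₀ (δx + δy) Sig k := by
      linarith
    calc ∫ ω, ‖(S k ω).x - xs‖ ^ 2 ∂P
        = w / (3 * c.Lxy) * (3 * c.Lxy / w * ∫ ω, ‖(S k ω).x - xs‖ ^ 2 ∂P) := by field_simp
      _ ≤ _ := by gcongr
  · have h1 : 0 ≤ 3 * c.Lxy / w * ∫ ω, ‖(S k ω).x - xs‖ ^ 2 ∂P := by positivity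
    have h2 : 4 * c.Lxy * w * ∫ ω, ‖(S k ω).y - ys‖ ^ 2 ∂P ≤ errorBound p.θ Ψ₀ (δx + δy) Sig k := by
      linarith
    calc ∫ ω, ‖(S k ω).y - ys‖ ^ 2 ∂P
        = 1 / (4 * c.Lxy * w) * (4 * c.Lxy * w * ∫ ω, ‖(S k ω).y - ys‖ ^ 2 ∂P) := by field_simp
      _ ≤ _ := by gcongr

/-! ### Choice of the parameters -/

/-- Step size `η` and weight `α` of one block are compatible with the target `1 / (1 - θ) = N`,
where `σ = 2 / N` and `β` is as large as the estimates permit. Here `L`, `μ` are the constants of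
the block, `L'` is the smoothness of the other function, `K` bounds the norm of the coupling matrix,
`ν` is the coupling constant of the block and `w` its weight. -/
structure BlockStep (N L L' K μ ν w η α : ℝ) : Prop where
  η_pos : 0 < η
  α_nonneg : 0 ≤ α
  α_le : α ≤ μ
  α_pos : 0 < μ → 0 < α
  smooth : η * (α + L * (2 / N)) ≤ 1 / 4
  coupling : η ≤ w / (4 * K)
  rate : 1 / N ≤ η * (α + min (1 / (2 * L')) (1 / (2 * η * K ^ 2)) * ν ^ 2)

lemma exists_params_of_blockStep {c : Constants} (hc : c.Admissible) {w N ηx αx ηy αy : ℝ}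
    (hw : 0 < w) (hN : 2 ≤ N)
    (hx : BlockStep N c.Lx c.Ly c.Lxy c.μx c.μyx w ηx αx)
    (hy : BlockStep N c.Ly c.Lx c.Lxy c.μy c.μxy (1 / w) ηy αy) :
    ∃ p : Params, p.Valid c ∧ 1 / (1 - p.θ) = N ∧ p.Contracting c w := by
  have hN0 : 0 < N := by linarith
  have hLx := hc.Lx_pos; have hLy := hc.Ly_pos; have hL := hc.Lxy_pos
  have hηx := hx.η_pos; have hηy := hy.η_pos
  have hσ : 2 / N ∈ Set.Ioc (0 : ℝ) 1 := ⟨by positivity, (div_le_one hN0).2 hN⟩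
  have hτ : (1 / (2 / N) + 1 / 2)⁻¹ ∈ Set.Ioc (0 : ℝ) 1 := by
    have h1 : 1 ≤ 1 / (2 / N) + 1 / 2 := by rw [one_div_div]; linarith
    exact ⟨by positivity, inv_le_one_of_one_le₀ h1⟩
  have hcoup : ∀ {η a : ℝ}, 0 < η → min a (1 / (2 * η * c.Lxy ^ 2)) * η * c.Lxy ^ 2 ≤ 1 / 2 := by
    intro η a hη
    have h1 : min a (1 / (2 * η * c.Lxy ^ 2)) * (η * c.Lxy ^ 2) ≤
        1 / (2 * η * c.Lxy ^ 2) * (η * c.Lxy ^ 2) := by gcongr; exact min_le_right _ _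
    have h2 : 1 / (2 * η * c.Lxy ^ 2) * (η * c.Lxy ^ 2) = 1 / 2 := by field_simp
    linarith
  have hsm : ∀ {L b : ℝ}, 0 < L → min (1 / (2 * L)) b * (2 * L) ≤ 1 := by
    intro L b hL
    rw [← le_div_iff₀ (by positivity)]
    exact min_le_left _ _
  have hN' : 1 / N ≤ 1 / 2 := one_div_le_one_div_of_le two_pos hN
  refine ⟨⟨ηx, ηy, αx, αy, min (1 / (2 * c.Ly)) (1 / (2 * ηx * c.Lxy ^ 2)),
    min (1 / (2 * c.Lx)) (1 / (2 * ηy * c.Lxy ^ 2)), (1 / (2 / N) + 1 / 2)⁻¹,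
    (1 / (2 / N) + 1 / 2)⁻¹, 2 / N, 2 / N, 1 - 1 / N⟩, ?_, ?_, ?_⟩
  · exact
    { ηx_pos := hηx
      ηy_pos := hηy
      αx_nonneg := hx.α_nonneg
      αy_nonneg := hy.α_nonneg
      αx_pos := hx.α_pos
      αy_pos := hy.α_pos
      βx_pos := lt_min (by positivity) (by positivity)
      βy_pos := lt_min (by positivity) (by positivity)
      τx_mem := hτ
      τy_mem := hτ
      σx_mem := hσ
      σy_mem := hσ
      θ_mem := ⟨by simp only; linarith, by simp only; linarith [one_div_pos.2 hN0]⟩ }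
  · simp
  · have hθ : 1 - (1 - 1 / N) ≤ 2 / N / 2 := by apply le_of_eq; ring
    exact
    { w_pos := hw
      αx_le := hx.α_le
      αy_le := hy.α_le
      τx_eq := rfl
      τy_eq := rfl
      ηx_smooth := hx.smooth
      ηy_smooth := hy.smooth
      ηx_coupling := hx.coupling
      ηy_coupling := hy.coupling.trans_eq (by field_simp)
      βx_smooth := hsm hLy
      βy_smooth := hsm hLx
      βx_coupling := hcoup hηx
      βy_coupling := hcoup hηy
      θ_σx := hθ
      θ_σy := hθ
      θ_x := by rw [sub_sub_cancel]; exact hx.rate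
      θ_y := by rw [sub_sub_cancel]; exact hy.rate }

/-- A block that contracts through its strong convexity. -/
lemma BlockStep.of_stronglyConvex {N L L' K μ ν w κ : ℝ} (hL' : 0 < L') (hK : 0 < K)
    (hμ : 0 < μ) (hκ : 0 ≤ κ) (hLκ : L ≤ μ * κ ^ 2) (hN : 4 + 4 * κ ≤ N)
    (hw : 4 * K ≤ N * (μ * w)) : BlockStep N L L' K μ ν w (1 / (μ * N)) μ := by
  have hN0 : 0 < N := by linarith
  refine ⟨by positivity, hμ.le, le_rfl, fun _ => hμ, ?_, ?_, ?_⟩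
  · have h1 : 16 * κ ^ 2 ≤ N * (N - 4) := by
      have h2 : (4 * κ) * (4 * κ) ≤ N * (N - 4) :=
        mul_le_mul (by linarith) (by linarith) (by linarith) hN0.le
      linarith
    have h2 : 8 * L ≤ μ * (N * (N - 4)) := by
      have h3 := mul_le_mul_of_nonneg_left h1 hμ.le
      have h4 : 0 ≤ μ * κ ^ 2 := by positivity
      linarith
    have e : 1 / (μ * N) * (μ + L * (2 / N)) = (μ * N + 2 * L) / (μ * N ^ 2) := by
      field_simp
    rw [e, div_le_div_iff₀ (by positivity) (by norm_num)]
    linarith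
  · rw [div_le_div_iff₀ (by positivity) (by positivity)]
    linarith
  · have e : 1 / (μ * N) * μ = 1 / N := by field_simp
    have : 0 ≤ 1 / (μ * N) * (min (1 / (2 * L')) (1 / (2 * (1 / (μ * N)) * K ^ 2)) * ν ^ 2) := by
      have : 0 ≤ min (1 / (2 * L')) (1 / (2 * (1 / (μ * N)) * K ^ 2)) :=
        le_min (by positivity) (by positivity)
      positivity
    rw [mul_add, e]
    linarith

/-- A block that contracts through the coupling. Its own strong convexity may be arbitrarily large
compared with the rate, so only a part `α` of it is used. -/
lemma BlockStep.of_coupling {N L L' K μ ν w : ℝ} (hL : 0 < L) (hL' : 0 < L') (hK : 0 < K)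
    (hμ : 0 ≤ μ) (hν : 0 < ν) (hN : 0 < N) (h1 : 32 * (L * L') ≤ ν ^ 2 * N ^ 2)
    (h2 : 8 * (L' * K) ≤ w * ν ^ 2 * N) (h3 : 2 * K ^ 2 ≤ ν ^ 2 * N) :
    BlockStep N L L' K μ ν w (2 * L' / (ν ^ 2 * N)) (min μ (L * (2 / N))) := by
  have hα : 0 ≤ min μ (L * (2 / N)) := le_min hμ (by positivity)
  refine ⟨by positivity, hα, min_le_left _ _, fun h => lt_min h (by positivity), ?_, ?_, ?_⟩
  · calc 2 * L' / (ν ^ 2 * N) * (min μ (L * (2 / N)) + L * (2 / N))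
        ≤ 2 * L' / (ν ^ 2 * N) * (L * (2 / N) + L * (2 / N)) := by
          gcongr; exact min_le_right _ _
      _ = 8 * (L * L') / (ν ^ 2 * N ^ 2) := by field_simp; ring
      _ ≤ 1 / 4 := by
          rw [div_le_div_iff₀ (by positivity) (by norm_num)]
          linarith
  · rw [div_le_div_iff₀ (by positivity) (by positivity)]
    linarith
  · have key : 1 / N ≤ 2 * L' / (ν ^ 2 * N) *
        (min (1 / (2 * L')) (1 / (2 * (2 * L' / (ν ^ 2 * N)) * K ^ 2)) * ν ^ 2) := by
      rcases min_choice (1 / (2 * L')) (1 / (2 * (2 * L' / (ν ^ 2 * N)) * K ^ 2)) with h | h <;>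
        rw [h]
      · apply le_of_eq
        field_simp
      · have e : 2 * L' / (ν ^ 2 * N) * (1 / (2 * (2 * L' / (ν ^ 2 * N)) * K ^ 2) * ν ^ 2) =
            ν ^ 2 / (2 * K ^ 2) := by field_simp
        rw [e, div_le_div_iff₀ hN (by positivity)]
        linarith
    have : 0 ≤ 2 * L' / (ν ^ 2 * N) * min μ (L * (2 / N)) := by positivity
    rw [mul_add]
    linarith

/-- One function strongly convex, and the other block coupled: `N` and the weight `v` of the
strongly convex block. -/
lemma blockStep_of_stronglyConvex_of_coupling {L L' K μ μ' ν ν' N v : ℝ} (hL : 0 < L)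
    (hL' : 0 < L') (hK : 0 < K) (hμ : 0 < μ) (hμ' : 0 ≤ μ') (hν : 0 < ν) (hνK : ν ≤ K)
    (hN : N = 4 + 8 * max (√(L * L') / ν) (max (K / ν * √(L / μ)) (K ^ 2 / ν ^ 2)))
    (hv : v = √(ν ^ 2 / (2 * μ * L))) :
    ∃ η α η' α', BlockStep N L L' K μ ν' v η α ∧ BlockStep N L' L K μ' ν (1 / v) η' α' := by
  set M := max (√(L * L') / ν) (max (K / ν * √(L / μ)) (K ^ 2 / ν ^ 2))
  have m1 : √(L * L') / ν ≤ M := le_max_left _ _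
  have m2 : K / ν * √(L / μ) ≤ M := (le_max_left _ _).trans (le_max_right _ _)
  have m3 : K ^ 2 / ν ^ 2 ≤ M := (le_max_right _ _).trans (le_max_right _ _)
  have hM : 0 ≤ M := le_trans (by positivity) m1
  have hN0 : 0 < N := by linarith
  have hκ2 : √(L / μ) ^ 2 = L / μ := Real.sq_sqrt (by positivity)
  have hκ0 : 0 < √(L / μ) := by positivity
  set κ := √(L / μ)
  have hκM : κ ≤ M := by
    refine le_trans ?_ m2
    exact le_mul_of_one_le_left hκ0.le ((one_le_div hν).2 hνK)
  have hLκ : L = μ * κ ^ 2 := by rw [hκ2]; field_simp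
  have ht2 : √2 ^ 2 = (2 : ℝ) := Real.sq_sqrt zero_le_two
  have ht0 : 0 < √(2 : ℝ) := by positivity
  have ht1 : 1 ≤ √(2 : ℝ) := Real.one_le_sqrt.2 one_le_two
  -- `√(ν² / (2 μ L))` in terms of the square root `κ` of the condition number
  have hv' : v = ν / (√2 * (μ * κ)) := by
    rw [hv, ← Real.sqrt_sq (by positivity : 0 ≤ ν / (√2 * (μ * κ)))]
    congr 1
    rw [div_pow, mul_pow, ht2, hLκ]
    ring
  have m2' : K * κ ≤ ν * M := by
    rw [div_mul_eq_mul_div, div_le_iff₀ hν] at m2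
    linarith
  refine ⟨_, _, _, _, BlockStep.of_stronglyConvex hL' hK hμ hκ0.le hLκ.le (by linarith) ?_,
    BlockStep.of_coupling hL' hL hK hμ' hν hN0 ?_ ?_ ?_⟩
  · have e : N * (μ * v) = N * ν / (√2 * κ) := by rw [hv']; field_simp
    rw [e, le_div_iff₀ (by positivity)]
    have h1 : √(2 : ℝ) ≤ 2 := by rw [Real.sqrt_le_left two_pos.le]; norm_num
    calc 4 * K * (√2 * κ) = √2 * (4 * (K * κ)) := by ring
      _ ≤ 2 * (4 * (ν * M)) := by gcongr
      _ ≤ N * ν := by rw [hN]; linarith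
  · rw [div_le_iff₀ hν] at m1
    have h1 : √(L * L') * 8 ≤ ν * N := by rw [hN]; linarith
    have h2 := pow_le_pow_left₀ (by positivity) h1 2
    rw [mul_pow, mul_pow, Real.sq_sqrt (by positivity)] at h2
    have : 0 < L * L' := by positivity
    linarith
  · have e : 1 / v * ν ^ 2 * N = √2 * (μ * κ) * (ν * N) := by rw [hv']; field_simp
    have h1 : 8 * (K * κ) ≤ ν * N := by rw [hN]; linarith
    rw [e]
    calc 8 * (L * K) = 1 * (μ * κ) * (8 * (K * κ)) := by rw [hLκ]; ring
      _ ≤ √2 * (μ * κ) * (ν * N) :=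
        mul_le_mul (by gcongr) h1 (by positivity) (by positivity)
  · rw [div_le_iff₀ (by positivity)] at m3
    have h1 : ν ^ 2 * (8 * M) ≤ ν ^ 2 * N := by gcongr; linarith
    have : 0 ≤ K ^ 2 := by positivity
    linarith

/-- Both blocks coupled: one of them. -/
lemma blockStep_of_coupling_of_coupling {L L' K μ ν ν' N : ℝ} (hL : 0 < L)
    (hL' : 0 < L') (hK : 0 < K) (hμ : 0 ≤ μ) (hν : 0 < ν) (hν' : 0 < ν') (hνK : ν' ≤ K)
    (h1 : 8 * (√(L * L') * K / (ν' * ν)) ≤ N) (h2 : 8 * (K ^ 2 / ν ^ 2) ≤ N) :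
    BlockStep N L L' K μ ν (ν' / ν * √(L' / L)) (2 * L' / (ν ^ 2 * N)) (min μ (L * (2 / N))) := by
  have hN0 : 0 < N := lt_of_lt_of_le (by positivity) h2
  have h1' : 8 * (√(L * L') * K) ≤ N * (ν' * ν) := by
    rwa [← mul_div_assoc, div_le_iff₀ (by positivity)] at h1
  refine BlockStep.of_coupling hL hL' hK hμ hν hN0 ?_ ?_ ?_
  · have h3 : √(L * L') * 8 ≤ ν * N := by
      refine le_of_mul_le_mul_right ?_ hν'
      calc √(L * L') * 8 * ν' ≤ √(L * L') * 8 * K := by gcongr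
        _ ≤ ν * N * ν' := by linarith
    have h4 := pow_le_pow_left₀ (by positivity) h3 2
    rw [mul_pow, mul_pow, Real.sq_sqrt (by positivity)] at h4
    have : 0 < L * L' := by positivity
    linarith
  · have e : √(L' / L) * √(L * L') = L' := by
      rw [← Real.sqrt_mul (by positivity), ← Real.sqrt_sq hL'.le]
      congr 1
      field_simp
      rw [Real.sqrt_sq hL'.le]
    calc 8 * (L' * K) = √(L' / L) * (8 * (√(L * L') * K)) := by
          linear_combination (-8 * K) * e
      _ ≤ √(L' / L) * (N * (ν' * ν)) := by gcongr
      _ = ν' / ν * √(L' / L) * ν ^ 2 * N := by field_simp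
  · rw [← mul_div_assoc, div_le_iff₀ (by positivity)] at h2
    have : 0 ≤ K ^ 2 := by positivity
    linarith

/-- No problem satisfies the assumptions if `μ_xy > L_xy` or `μ_yx > L_xy`, so any parameters will
do. -/
lemma exists_params_of_lt {c : Constants} (hc : c.Admissible)
    (h : (0 < c.μxy ∧ c.Lxy < c.μxy) ∨ (0 < c.μyx ∧ c.Lxy < c.μyx)) {N w : ℝ} (hN : 2 ≤ N) :
    ∃ p : Params, p.Valid c ∧ 1 / (1 - p.θ) ≤ N ∧ Converges.{u, v} c w p := by
  refine ⟨⟨1, 1, 1, 1, 1, 1, 1, 1, 1, 1, 1 / 2⟩, ?_, by norm_num; exact hN, ?_⟩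
  · constructor <;> norm_num
  · intro dx dy rf rg hdx hdy _ _ A f g _ _ _ _ _ Ω _ P _ Ξ _ ξx ξy Gf Gg Δx Δy δx δy σf σg x₀ y₀ _
      hcoup
    obtain ⟨hA, hA'⟩ := hcoup.norm_le hc
    exfalso
    rcases h with ⟨h0, h⟩ | ⟨h0, h⟩
    · have h1 := hcoup.μxy_bound_pos
      have h2 := hcoup.μxy_bound
      rw [← Matrix.transpose_transpose A, Matrix.transpose_transpose Aᵀ] at h1 h2
      exact h.not_ge (le_of_spectrum_bounds h0 hdy Aᵀ hA' h1 h2)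
    · exact h.not_ge (le_of_spectrum_bounds h0 hdx A hA hcoup.μyx_bound_pos hcoup.μyx_bound)

lemma exists_converges_of_blockStep {c : Constants} (hc : c.Admissible) {w N ηx αx ηy αy : ℝ}
    (hw : 0 < w) (hN : 2 ≤ N)
    (hx : BlockStep N c.Lx c.Ly c.Lxy c.μx c.μyx w ηx αx)
    (hy : BlockStep N c.Ly c.Lx c.Lxy c.μy c.μxy (1 / w) ηy αy) :
    ∃ p : Params, p.Valid c ∧ 1 / (1 - p.θ) ≤ N ∧ Converges.{u, v} c w p := by
  obtain ⟨p, hv, hθ, hp⟩ := exists_params_of_blockStep hc hw hN hx hy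
  exact ⟨p, hv, hθ.le, hp.converges hc hv⟩

end APDG

theorem mainTheorem1 (c : APDG.Constants) (hc : c.Admissible) :
    -- strongly convex, strongly concave
    (0 < c.μx → 0 < c.μy →
      ∃ p : APDG.Params, p.Valid c ∧
        1 / (1 - p.θ) ≤ 4 + 4 * max (√(c.Lx / c.μx))
          (max (√(c.Ly / c.μy)) (c.Lxy / √(c.μx * c.μy))) ∧
        APDG.Converges.{u, v} c (√(c.μy / c.μx)) p) ∧
    -- strongly convex in `x` and `μ_xy > 0`
    (0 < c.μx → 0 < c.μxy →
      ∃ p : APDG.Params, p.Valid c ∧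
        1 / (1 - p.θ) ≤ 4 + 8 * max (√(c.Lx * c.Ly) / c.μxy)
          (max (c.Lxy / c.μxy * √(c.Lx / c.μx)) (c.Lxy ^ 2 / c.μxy ^ 2)) ∧
        APDG.Converges.{u, v} c (√(c.μxy ^ 2 / (2 * c.μx * c.Lx))) p) ∧
    -- strongly concave in `y` and `μ_yx > 0`
    (0 < c.μy → 0 < c.μyx →
      ∃ p : APDG.Params, p.Valid c ∧
        1 / (1 - p.θ) ≤ 4 + 8 * max (√(c.Lx * c.Ly) / c.μyx)
          (max (c.Lxy / c.μyx * √(c.Ly / c.μy)) (c.Lxy ^ 2 / c.μyx ^ 2)) ∧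
        APDG.Converges.{u, v} c (√(2 * c.μy * c.Ly / c.μyx ^ 2)) p) ∧
    -- `μ_xy > 0` and `μ_yx > 0`
    (0 < c.μxy → 0 < c.μyx →
      ∃ p : APDG.Params, p.Valid c ∧
        1 / (1 - p.θ) ≤ 2 + 8 * max (√(c.Lx * c.Ly) * c.Lxy / (c.μxy * c.μyx))
          (max (c.Lxy ^ 2 / c.μyx ^ 2) (c.Lxy ^ 2 / c.μxy ^ 2)) ∧
        APDG.Converges.{u, v} c (c.μxy / c.μyx * √(c.Ly / c.Lx)) p) := by
  have hLx := hc.Lx_pos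
  have hLy := hc.Ly_pos
  have hK := hc.Lxy_pos
  refine ⟨fun hμx hμy => ?_, fun hμx hν => ?_, fun hμy hν => ?_, fun hν hν' => ?_⟩
  · set M := max (√(c.Lx / c.μx)) (max (√(c.Ly / c.μy)) (c.Lxy / √(c.μx * c.μy)))
    have m1 : √(c.Lx / c.μx) ≤ M := le_max_left _ _
    have m2 : √(c.Ly / c.μy) ≤ M := (le_max_left _ _).trans (le_max_right _ _)
    have m3 : c.Lxy / √(c.μx * c.μy) ≤ M := (le_max_right _ _).trans (le_max_right _ _)
    have hM : 0 ≤ M := (Real.sqrt_nonneg _).trans m1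
    have hw : 0 < √(c.μy / c.μx) := by positivity
    have e1 : c.μx * √(c.μy / c.μx) = √(c.μx * c.μy) := by
      rw [Real.sqrt_div hμy.le, Real.sqrt_mul hμx.le]
      have h1 := Real.mul_self_sqrt hμx.le
      have h2 : 0 < √c.μx := by positivity
      field_simp
      linear_combination -h1
    have e2 : c.μy * (1 / √(c.μy / c.μx)) = √(c.μx * c.μy) := by
      rw [mul_one_div, div_eq_iff hw.ne', ← e1, mul_assoc, Real.mul_self_sqrt (by positivity)]
      field_simp
    have h4 : 4 * c.Lxy ≤ (4 + 4 * M) * √(c.μx * c.μy) := by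
      rw [div_le_iff₀ (by positivity)] at m3
      have : 0 < √(c.μx * c.μy) := by positivity
      linarith
    have hκ : ∀ {L μ : ℝ}, 0 < L → 0 < μ → L ≤ μ * √(L / μ) ^ 2 := by
      intro L μ hL hμ
      rw [Real.sq_sqrt (by positivity)]
      exact (mul_div_cancel₀ L hμ.ne').ge
    exact APDG.exists_converges_of_blockStep hc hw (by linarith)
      (APDG.BlockStep.of_stronglyConvex hLy hK hμx (Real.sqrt_nonneg _) (hκ hLx hμx) (by linarith)
        (by rw [e1]; exact h4))
      (APDG.BlockStep.of_stronglyConvex hLx hK hμy (Real.sqrt_nonneg _) (hκ hLy hμy) (by linarith)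
        (by rw [e2]; exact h4))
  · set N := 4 + 8 * max (√(c.Lx * c.Ly) / c.μxy)
      (max (c.Lxy / c.μxy * √(c.Lx / c.μx)) (c.Lxy ^ 2 / c.μxy ^ 2)) with hN
    have hN2 : 2 ≤ N := by
      have : 0 ≤ max (√(c.Lx * c.Ly) / c.μxy)
        (max (c.Lxy / c.μxy * √(c.Lx / c.μx)) (c.Lxy ^ 2 / c.μxy ^ 2)) :=
        le_max_of_le_left (by positivity)
      linarith
    rcases lt_or_ge c.Lxy c.μxy with h | h
    · exact APDG.exists_params_of_lt hc (Or.inl ⟨hν, h⟩) hN2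
    · obtain ⟨ηx, αx, ηy, αy, hx, hy⟩ := APDG.blockStep_of_stronglyConvex_of_coupling
        (ν' := c.μyx) hLx hLy hK hμx hc.μy_nonneg hν h hN rfl
      exact APDG.exists_converges_of_blockStep hc (by positivity) hN2 hx hy
  · rw [mul_comm c.Lx c.Ly]
    set N := 4 + 8 * max (√(c.Ly * c.Lx) / c.μyx)
      (max (c.Lxy / c.μyx * √(c.Ly / c.μy)) (c.Lxy ^ 2 / c.μyx ^ 2)) with hN
    have hN2 : 2 ≤ N := by
      have : 0 ≤ max (√(c.Ly * c.Lx) / c.μyx)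
        (max (c.Lxy / c.μyx * √(c.Ly / c.μy)) (c.Lxy ^ 2 / c.μyx ^ 2)) :=
        le_max_of_le_left (by positivity)
      linarith
    rcases lt_or_ge c.Lxy c.μyx with h | h
    · exact APDG.exists_params_of_lt hc (Or.inr ⟨hν, h⟩) hN2
    · obtain ⟨ηy, αy, ηx, αx, hy, hx⟩ := APDG.blockStep_of_stronglyConvex_of_coupling
        (ν' := c.μxy) hLy hLx hK hμy hc.μx_nonneg hν h hN rfl
      -- the weight of the `x` block is the inverse of that of the `y` block
      have e : √(c.μyx ^ 2 / (2 * c.μy * c.Ly)) = 1 / √(2 * c.μy * c.Ly / c.μyx ^ 2) := by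
        rw [one_div, ← Real.sqrt_inv, inv_div]
      rw [e] at hx hy
      rw [one_div_one_div] at hx
      exact APDG.exists_converges_of_blockStep hc (by positivity) hN2 hx hy
  · set M := max (√(c.Lx * c.Ly) * c.Lxy / (c.μxy * c.μyx))
      (max (c.Lxy ^ 2 / c.μyx ^ 2) (c.Lxy ^ 2 / c.μxy ^ 2))
    have m1 : √(c.Lx * c.Ly) * c.Lxy / (c.μxy * c.μyx) ≤ M := le_max_left _ _
    have m2 : c.Lxy ^ 2 / c.μyx ^ 2 ≤ M := (le_max_left _ _).trans (le_max_right _ _)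
    have m3 : c.Lxy ^ 2 / c.μxy ^ 2 ≤ M := (le_max_right _ _).trans (le_max_right _ _)
    have hM : 0 ≤ M := le_trans (by positivity) m1
    have hN2 : 2 ≤ 2 + 8 * M := by linarith
    rcases lt_or_ge c.Lxy c.μxy with h | h
    · exact APDG.exists_params_of_lt hc (Or.inl ⟨hν, h⟩) hN2
    rcases lt_or_ge c.Lxy c.μyx with h' | h'
    · exact APDG.exists_params_of_lt hc (Or.inr ⟨hν', h'⟩) hN2
    have e : 1 / (c.μxy / c.μyx * √(c.Ly / c.Lx)) = c.μyx / c.μxy * √(c.Lx / c.Ly) := by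
      rw [one_div, mul_inv, inv_div, ← Real.sqrt_inv, inv_div]
    have hx := APDG.blockStep_of_coupling_of_coupling (N := 2 + 8 * M) hLx hLy hK hc.μx_nonneg
      hν' hν h (by linarith) (by linarith)
    have hy := APDG.blockStep_of_coupling_of_coupling (N := 2 + 8 * M) hLy hLx hK hc.μy_nonneg
      hν hν' h' (by rw [mul_comm c.Ly c.Lx, mul_comm c.μyx c.μxy]; linarith) (by linarith)
    rw [← e] at hy
    exact APDG.exists_converges_of_blockStep hc (by positivity) hN2 hx hy
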